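/- **Conventions.** Points and lines of $\mathrm{PG}(W)$ are the 1- and 2-dimensional subspaces of $W$; $\langle\cdot\rangle$ is linear span. A *$d$-embedding* ($d\ge 1$) of a point-line geometry $(\mathcal P,\mathcal L)$ in $\mathrm{PG}(W)$ is an injective map $\varepsilon$ from $\mathcal P$ to the points of $\mathrm{PG}(W)$ with $\langle\varepsilon(\mathcal P)\rangle=W$ such that, for every $l\in\mathcal L$, $\langle\varepsilon(l)\rangle$ has projective dimension $d$ and contains $\varepsilon(p)$ only for $p\in l$. Its dimension is the projective dimension $\dim W-1$. Two embeddings $\varepsilon_1,\varepsilon_2$ of the same geometry in $\mathrm{PG}(W_1)$, $\mathrm{PG}(W_2)$ are *isomorphic* ($\varepsilon_1\cong\varepsilon_2$) if there is a bijective semilinear map $f:W_1\to W_2$ (relative to some automorphism of the field) with $f(\varepsilon_1(p))=\varepsilon_2(p)$ for all points $p$. A subspace $K\le W$ *defines a $k$-quotient* of a $d$-embedding $\varepsilon$ if $0\le k<d$, $(\varepsilon(p)+\varepsilon(q))\cap K=0$ for all points $p,q$ (possibly equal), $\varepsilon(p)\cap(\langle\varepsilon(l)\rangle+K)=0$ whenever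 $p\notin l$, and $\dim(K\cap\langle\varepsilon(l)\rangle)=k$ (vector dimension) for every line $l$; then $\varepsilon/K$ is the map $p\mapsto(\varepsilon(p)+K)/K$ to points of $\mathrm{PG}(W/K)$. **Setting.** Let $\mathbb F$ be a field of characteristic $2$, $V=\mathbb F^5$, and $\chi$ a quadratic form on $V$ that is non-singular (no nonzero vector $v$ with $\chi(v)=0$ lies in the radical of the bilinearization of $\chi$) and of Witt index $2$. Let $\Gamma=(\mathcal P,\mathcal L)\cong Q(4,\mathbb F)$ be the geometry of the singular points and totally singular lines of $\chi$, $\varepsilon_0:\Gamma\to\mathrm{PG}(V)$ the inclusion, and $\Gamma^*$ the dual of $\Gamma$: its points are the lines of $\Gamma$ and its lines are the sets of all lines of $\Gamma$ through a given point. Let $V^{\otimes}=\mathbb F^{15}$ with coordinates indexed by the pairs $1\le i\le j\le 5$, let $\eta^{\mathrm{ver}}:\langle x\rangle\mapsto\langle (x_ix_j)_{i\le j}\rangle$ be the quadric veronesean map from the points of $\mathrm{PG}(V)$ to those of $\mathrm{PG}(V^{\otimes})$, and put $\varepsilon_0^{\mathrm{ver}}=\eta^{\mathrm{ver}}\varepsilon_0$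 and $H=\langle\varepsilon_0^{\mathrm{ver}}(\mathcal P)\rangle$. For a line $\ell$ of $\mathrm{PG}(V)$ let $\nu(\ell)$ be the nucleus of the conic $\eta^{\mathrm{ver}}(\ell)$, that is, the intersection of all its tangent lines (lines of the plane $\langle\eta^{\mathrm{ver}}(\ell)\rangle$ meeting the conic in exactly one point). Let $N$ be the span of all $\nu(\ell)$ with $\ell$ a line of $\mathrm{PG}(V)$, let $N_\Gamma$ be the span of the nuclei of the conics $\varepsilon_0^{\mathrm{ver}}(l)$, $l\in\mathcal L$, and let $N_H=H\cap N$. Write $\nu\cdot\varepsilon_0^{\mathrm{ver}}$ for the map sending each point $l$ of $\Gamma^*$ to the nucleus of $\varepsilon_0^{\mathrm{ver}}(l)$, and $\varepsilon_0^{\mathrm{gr}}$ (the Grassmann embedding of $\Gamma^*$ induced by $\varepsilon_0$) for the map sending $l$ to $\langle x\wedge y\rangle\in\mathrm{PG}(V\wedge V)$, where $\langle\varepsilon_0(l)\rangle=\langle x,y\rangle$. **Proposition.** Here $\Gamma^*\cong W(3,\mathbb F)$ (the points of $\mathrm{PG}(3,\mathbb F)$ and the totally isotropic lines of a non-degenerate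 alternating form on $\mathbb F^4$), and $\nu(\ell)$ is a point for every line $\ell$ of $\mathrm{PG}(V)$. Moreover: 1. $N_\Gamma=N_H$. 2. $\varepsilon_0^{\mathrm{ver}}$ is a $2$-embedding of $\Gamma$ in $\mathrm{PG}(H)$; $N_H$ defines a $1$-quotient of it, $\varepsilon_0^{\mathrm{ver}}/N_H$ is a $1$-embedding of $\Gamma$ in $\mathrm{PG}(H/N_H)$, and $\dim(\varepsilon_0^{\mathrm{ver}}/N_H)=4$ (that is, $\dim(H/N_H)=5$ as a vector space). 3. $\nu\cdot\varepsilon_0^{\mathrm{ver}}$ and $\varepsilon_0^{\mathrm{gr}}$ are $2$-embeddings of $\Gamma^*\cong W(3,\mathbb F)$ in the projective spaces of the spans of their images, and $\nu\cdot\varepsilon_0^{\mathrm{ver}}\cong\varepsilon_0^{\mathrm{gr}}$. 4. If $\mathbb F$ is perfect, then $\varepsilon_0^{\mathrm{ver}}/N_H\cong\varepsilon_0$. -/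

import Mathlib

noncomputable section

namespace ConicNuclei

open Module

universe u

/-! Throughout, the points of the projective space `PG(W)` of a vector space `W` are the
one-dimensional subspaces of `W`, its lines are the two-dimensional subspaces, and projective spans
are linear spans (suprema in the lattice of subspaces). -/

/-- A point-line geometry: a set of points, and a set of lines, each line being a set of points. -/
structure PointLineGeometry where
  /-- the points -/
  Pt : Type u
  /-- the lines -/
  lines : Set (Set Pt)

namespace PointLineGeometry

/-- The dual geometry: its points are the lines of `Γ`, its lines are the sets
`L(p)` of all lines of `Γ` through a point `p`. -/
def dual (Γ : PointLineGeometry.{u}) : PointLineGeometry.{u} where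
  Pt := {l : Set Γ.Pt // l ∈ Γ.lines}
  lines := {S | ∃ p : Γ.Pt, S = {l | p ∈ l.1}}

/-- Two geometries are isomorphic: a bijection of the points that carries lines to lines in both
directions. -/
def Isomorphic (Γ₁ Γ₂ : PointLineGeometry.{u}) : Prop :=
  ∃ e : Γ₁.Pt ≃ Γ₂.Pt, ∀ s : Set Γ₁.Pt, s ∈ Γ₁.lines ↔ e '' s ∈ Γ₂.lines

end PointLineGeometry

section Embeddings

variable {F W W₁ W₂ : Type*} [Field F] [AddCommMonoid W] [Module F W]
  [AddCommMonoid W₁] [Module F W₁] [AddCommMonoid W₂] [Module F W₂]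

/-- The span `⟨ε(l)⟩` of the image of a set `l` of points. -/
def lineSpan {P : Type*} (ε : P → Submodule F W) (l : Set P) : Submodule F W :=
  ⨆ p ∈ l, ε p

/-- The span `⟨ε(𝒫)⟩` of the image of all points. -/
def imageSpan {P : Type*} (ε : P → Submodule F W) : Submodule F W :=
  ⨆ p, ε p

/-- A locally `d`-dimensional embedding of `Γ` in `PG(W)`: an injective map from the points of `Γ`
to the points of `PG(W)` whose image spans `PG(W)`, such that the image of each line `l` spans a
subspace of projective dimension `d` (vector dimension `d + 1`) that contains no further image point. -/
structure IsLocalEmbedding (Γ : PointLineGeometry.{u}) (d : ℕ)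
    (ε : Γ.Pt → Submodule F W) : Prop where
  pos : 0 < d
  point : ∀ p, finrank F (ε p) = 1
  injective : Function.Injective ε
  /-- the image of a line spans a subspace of projective dimension `d` -/
  line_dim : ∀ l ∈ Γ.lines, finrank F (lineSpan ε l) = d + 1
  /-- `⟨ε(l)⟩ ∩ ε(𝒫) = ε(l)` -/
  line_full : ∀ l ∈ Γ.lines, ∀ p, ε p ≤ lineSpan ε l → p ∈ l
  /-- the image spans the whole space -/
  span_top : imageSpan ε = ⊤

/-- `ε` with its codomain `PG(W)` replaced by the projective space of `⟨ε(𝒫)⟩`. -/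
def restrictToSpan {P : Type*} (ε : P → Submodule F W) : P → Submodule F (imageSpan ε) :=
  fun p => (ε p).submoduleOf (imageSpan ε)

/-- Isomorphism `ε₁ ≅ ε₂`: a bijective semilinear map `f : W₁ → W₂` (semilinear with respect
to some automorphism `σ` of the field) with `f ∘ ε₁ = ε₂`. -/
def EmbeddingIso {P : Type*} (ε₁ : P → Submodule F W₁) (ε₂ : P → Submodule F W₂) : Prop :=
  ∃ (σ : F ≃+* F) (f : W₁ →ₛₗ[(σ : F →+* F)] W₂),
    Function.Bijective f ∧ ∀ p, (ε₁ p).map f = ε₂ p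

/-- The subspace `K` defines a `k`-quotient of the `d`-embedding `ε` of `Γ`: it is disjoint
from the joins of image points, adding it to `⟨ε(l)⟩` captures no image point off `l`, and it meets
every `⟨ε(l)⟩` in a subspace of vector dimension `k < d`. -/
structure DefinesQuotient (Γ : PointLineGeometry.{u}) (d k : ℕ)
    (ε : Γ.Pt → Submodule F W) (K : Submodule F W) : Prop where
  disjoint_pair : ∀ p q, (ε p ⊔ ε q) ⊓ K = ⊥
  disjoint_line : ∀ l ∈ Γ.lines, ∀ p, p ∉ l → ε p ⊓ (lineSpan ε l ⊔ K) = ⊥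
  lt : k < d
  inf_line : ∀ l ∈ Γ.lines, finrank F (K ⊓ lineSpan ε l : Submodule F W) = k

/-- The quotient `ε/K`, which maps `p` to `⟨ε(p) ∪ K⟩ / K`, a subspace of `W/K`. -/
def quotientEmbedding {V : Type*} [AddCommGroup V] [Module F V] {P : Type*}
    (ε : P → Submodule F V) (K : Submodule F V) : P → Submodule F (V ⧸ K) :=
  fun p => (ε p).map K.mkQ

/-- `t` is a tangent line at the point `c` of the set `C` of points of `PG(W)`: a line of `⟨C⟩`
that meets `C` in `c` and in no other point. -/
def IsTangentLine (C : Set (Submodule F W)) (c t : Submodule F W) : Prop :=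
  finrank F t = 2 ∧ t ≤ sSup C ∧ c ∈ C ∧ ∀ x ∈ C, x ≤ t ↔ x = c

/-- The intersection of all tangent lines of `C`. If `C` is a non-singular conic (of the plane
`⟨C⟩`) over a field of characteristic 2, then this is a point: the nucleus of the conic. -/
def nucleus (C : Set (Submodule F W)) : Submodule F W :=
  sInf {t | ∃ c, IsTangentLine C c t}

end Embeddings

section Veronese

variable {F : Type u} [Field F] {n : ℕ}

/-- The space `V^⊗` of dimension `n(n+1)/2` that contains the quadric veronesean of `PG(V)`, where
`V = Fⁿ`: its coordinates are indexed by the pairs `(i, j)` with `i ≤ j`. -/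
abbrev VeroneseSpace (F : Type u) (n : ℕ) : Type u :=
  {p : Fin n × Fin n // p.1 ≤ p.2} → F

/-- The quadratic veronesean map `x ↦ (x_i x_j)_{i ≤ j}` on vectors. -/
def veroneseVec (x : Fin n → F) : VeroneseSpace F n :=
  fun p => x p.1.1 * x p.1.2

/-- The quadratic veronesean map `η^ver` on points: it sends `⟨x⟩` to `⟨(x_i x_j)_{i ≤ j}⟩`. -/
def veronese (p : Submodule F (Fin n → F)) : Submodule F (VeroneseSpace F n) :=
  Submodule.span F (veroneseVec '' (p : Set (Fin n → F)))

/-- The image `η^ver(U)` of (the set of points of) a subspace `U`; a conic when `U` is a line. -/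
def veroneseImage (U : Submodule F (Fin n → F)) : Set (Submodule F (VeroneseSpace F n)) :=
  {c | ∃ p : Submodule F (Fin n → F), finrank F p = 1 ∧ p ≤ U ∧ c = veronese p}

/-- The map `ν`: it sends a line `U` of `PG(V)` to the nucleus of the conic `η^ver(U)`. -/
def lineNucleus (U : Submodule F (Fin n → F)) : Submodule F (VeroneseSpace F n) :=
  nucleus (veroneseImage U)

variable (F n) in
/-- The subspace `N` spanned by the nuclei of the conics `η^ver(U)`, for all lines `U` of `PG(V)`. -/
def nucleusSpan : Submodule F (VeroneseSpace F n) :=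
  ⨆ (U : Submodule F (Fin n → F)) (_ : finrank F U = 2), lineNucleus U

/-- The natural embedding `ι₂` of the line-grassmannian of `PG(V)`: it sends the line `⟨x, y⟩` of
`PG(V)` to the point `⟨x ∧ y⟩` of `PG(V ∧ V)`. -/
def pluecker {V : Type*} [AddCommGroup V] [Module F V] (U : Submodule F V) :
    Submodule F (⋀[F]^2 V) :=
  Submodule.span F {z | ∃ x ∈ U, ∃ y ∈ U, z = exteriorPower.ιMulti F 2 ![x, y]}

/-- The veronesean embedding `ε^ver` induced by an embedding `ε` of a geometry in `PG(V)`, as a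
map to the points of `PG(V^⊗)`. -/
def veroneseanEmbedding {P : Type*} (ε : P → Submodule F (Fin n → F)) :
    P → Submodule F (VeroneseSpace F n) :=
  fun p => veronese (ε p)

/-- The composition of `ν` with `ε^ver`: it sends a line `l` of `Γ`, that is a point of the dual
geometry, to the nucleus of the conic `ε^ver(l)`. -/
def nucleusEmbedding (Γ : PointLineGeometry.{u}) (ε : Γ.Pt → Submodule F (Fin n → F)) :
    Γ.dual.Pt → Submodule F (VeroneseSpace F n) :=
  fun l => nucleus (veroneseanEmbedding ε '' l.1)

/-- The Grassmann embedding `ε^gr` of the dual geometry induced by a projective embedding `ε` of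
`Γ`: it sends a line `l` of `Γ` to `ι₂(⟨ε(l)⟩)`. -/
def grassmannEmbedding {V : Type*} [AddCommGroup V] [Module F V]
    (Γ : PointLineGeometry.{u}) (ε : Γ.Pt → Submodule F V) :
    Γ.dual.Pt → Submodule F (⋀[F]^2 V) :=
  fun l => pluecker (lineSpan ε l.1)

end Veronese

section Quadrangles

variable {F V : Type u} [Field F] [AddCommGroup V] [Module F V]

/-- `χ` is non-singular: the radical of its bilinearization has no non-zero singular vector. -/
def IsNonsingular (χ : QuadraticForm F V) : Prop :=
  ∀ v, χ v = 0 → (∀ w, QuadraticMap.polar χ v w = 0) → v = 0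

/-- `U` is totally singular for `χ`. -/
def IsTotallySingular (χ : QuadraticForm F V) (U : Submodule F V) : Prop :=
  ∀ v ∈ U, χ v = 0

/-- `χ` has Witt index `m`: the largest dimension of a totally singular subspace is `m`. -/
def HasWittIndex (χ : QuadraticForm F V) (m : ℕ) : Prop :=
  IsGreatest {k | ∃ U : Submodule F V, IsTotallySingular χ U ∧ finrank F U = k} m

/-- The geometry of the singular points and totally singular lines of `χ`. When `χ` is
non-singular of Witt index 2 and `V` has dimension 5, this is the quadrangle `Q(4, F)`. -/
def quadricGeometry (χ : QuadraticForm F V) : PointLineGeometry.{u} where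
  Pt := {p : Submodule F V // finrank F p = 1 ∧ IsTotallySingular χ p}
  lines := {l | ∃ U : Submodule F V, finrank F U = 2 ∧ IsTotallySingular χ U ∧
    l = {p | p.1 ≤ U}}

/-- The natural embedding `ε₀` of the geometry of `χ` in `PG(V)`. -/
def naturalEmbedding (χ : QuadraticForm F V) : (quadricGeometry χ).Pt → Submodule F V :=
  fun p => p.1

/-- A non-degenerate alternating form on `F⁴`. -/
def symplecticForm (x y : Fin 4 → F) : F :=
  x 0 * y 2 + x 1 * y 3 - x 2 * y 0 - x 3 * y 1

variable (F) in
/-- The symplectic quadrangle `W(3, F)`: all points of `PG(3, F)`, and the lines of `PG(3, F)` that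
are totally isotropic for a non-degenerate alternating form. -/
def symplecticQuadrangle : PointLineGeometry.{u} where
  Pt := {p : Submodule F (Fin 4 → F) // finrank F p = 1}
  lines := {l | ∃ U : Submodule F (Fin 4 → F), finrank F U = 2 ∧
    (∀ x ∈ U, ∀ y ∈ U, symplecticForm x y = 0) ∧ l = {p | p.1 ≤ U}}

variable {n : ℕ} (χ : QuadraticForm F (Fin n → F))

/-- `ε₀^ver`, as a map to the points of `PG(V^⊗)`. -/
def naturalVeronesean : (quadricGeometry χ).Pt → Submodule F (VeroneseSpace F n) :=
  veroneseanEmbedding (naturalEmbedding χ)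

/-- The subspace `H` of `V^⊗` spanned by `ε₀^ver(𝒫)`. -/
def spanH : Submodule F (VeroneseSpace F n) :=
  imageSpan (naturalVeronesean χ)

/-- `N_H = H ∩ N`. -/
def spanNH : Submodule F (VeroneseSpace F n) :=
  spanH χ ⊓ nucleusSpan F n

/-- `N_H`, regarded as a subspace of `H`. -/
def spanNHinH : Submodule F (spanH χ) :=
  (spanNH χ).submoduleOf (spanH χ)

/-- `ε₀^ver`, as a map to the points of `PG(H)`. -/
def naturalVeroneseanH : (quadricGeometry χ).Pt → Submodule F (spanH χ) :=
  restrictToSpan (naturalVeronesean χ)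

/-- `N_Γ`, the span of the nuclei of the conics `ε₀^ver(l)`, for all lines `l` of the geometry. -/
def spanNGamma : Submodule F (VeroneseSpace F n) :=
  imageSpan (nucleusEmbedding (quadricGeometry χ) (naturalEmbedding χ))

end Quadrangles

end ConicNuclei

end

/-! Everything rests on the polarization `veronesePolar x y`, the bilinear map π with η(x + y) =
η(x) + η(y) + π(x, y), where η is the veronesean map on vectors. In characteristic 2 it is
alternating, and the nucleus of the conic η(⟨x, y⟩) is the point ⟨π(x, y)⟩
(`lineNucleus_span_pair`). Hence x ∧ y ↦ π(x, y) extends to an injective linear map from V ∧ V into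
V^⊗ that carries the Grassmann point of a line to its nucleus (`wedgeToVeronese_injective`,
`map_pluecker`). This gives the isomorphism in item 3.

The span N of all nuclei is the kernel of the projection on the diagonal coordinates
(`nucleusSpan_eq_ker_diagonal`), and that projection sends η(x) to the vector of squares (x_i²). So
modulo N the veronesean is the coordinatewise Frobenius map. Squares of linear forms are linear
functionals on V^⊗ that vanish on N and still separate points from subspaces of V, which gives the
quotient conditions. The diagonal maps H onto V (`map_diagonal_spanH`), so H/N_H has dimension 5;
over a perfect field Frobenius can be inverted, and ε₀ is recovered.

The facts special to the quadric use the normal form χ = a(c₀c₂ + c₁c₃ + c₄²)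
(`exists_normal_basis`). Modulo N_Γ the space N is spanned by the single vector π(b₀, b₂). The form
χ, read as a linear functional on V^⊗, vanishes on H but not on that vector, so N_Γ = N_H. The
nuclei of the lines through b₀ span the three-dimensional space π(b₀, ⟨b₁, b₃, b₄⟩), so the dual
embeddings are 2-embeddings.

For the isomorphism of the dual with W(3, F), the even-degree relations of the Clifford algebra are
realized by letting V act on the spin module F⁴, by operators `T v` with square kχ(v) that are
self-adjoint for the symplectic form. A singular x corresponds to the totally isotropic line ker `T
x`, a point ⟨w⟩ to the totally singular line of all x with `T x w = 0`, and incidence on both sides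
is the one equation `T x w = 0`. -/

namespace ConicNuclei

open Module Submodule

/-! ### Points, lines and separating functionals -/

section LinearAlgebra

variable {F W : Type*} [Field F] [AddCommGroup W] [Module F W]

lemma exists_eq_span_singleton {p : Submodule F W} (hp : finrank F p = 1) :
    ∃ x, x ≠ 0 ∧ p = span F {x} := by
  obtain ⟨v, hv, hs⟩ := finrank_eq_one_iff'.1 hp
  refine ⟨v, by simpa using hv, le_antisymm (fun w hw => ?_) ?_⟩
  · obtain ⟨c, hc⟩ := hs ⟨w, hw⟩
    exact mem_span_singleton.2 ⟨c, by simpa using congrArg Subtype.val hc⟩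
  · rw [span_singleton_le_iff_mem]; exact v.2

lemma finrank_span_pair {x y : W} (h : LinearIndependent F ![x, y]) :
    finrank F (span F {x, y}) = 2 := by
  have := finrank_span_eq_card h
  rwa [Matrix.range_cons, Matrix.range_cons, Matrix.range_empty, Set.union_empty] at this

lemma exists_eq_span_pair {U : Submodule F W} (hU : finrank F U = 2) :
    ∃ x y, LinearIndependent F ![x, y] ∧ U = span F {x, y} := by
  have : Module.Finite F U := Module.finite_of_finrank_pos (by omega)
  let b := finBasisOfFinrankEq F U hU
  have hb : LinearIndependent F ![(b 0 : W), (b 1 : W)] := by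
    have he : ![(b 0 : W), (b 1 : W)] = U.subtype ∘ b := by
      ext i; fin_cases i <;> rfl
    rw [he]
    exact b.linearIndependent.map' U.subtype (ker_subtype U)
  have hle : span F {(b 0 : W), (b 1 : W)} ≤ U := by
    rw [span_le]; rintro _ (rfl | rfl) <;> exact SetLike.coe_mem _
  exact ⟨b 0, b 1, hb, (eq_of_le_of_finrank_eq hle (by rw [finrank_span_pair hb, hU])).symm⟩

lemma span_pair_eq_of_le {x y : W} (h : LinearIndependent F ![x, y]) {U : Submodule F W}
    (hU : finrank F U = 2) (hx : x ∈ U) (hy : y ∈ U) : U = span F {x, y} := by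
  have : Module.Finite F U := Module.finite_of_finrank_pos (by omega)
  have hle : span F {x, y} ≤ U := by
    rw [span_le]; rintro _ (rfl | rfl) <;> assumption
  exact (eq_of_le_of_finrank_eq hle (by rw [finrank_span_pair h, hU])).symm

lemma exists_eq_span_pair_of_mem {U : Submodule F W} (hU : finrank F U = 2) {x : W} (hx : x ∈ U)
    (hx0 : x ≠ 0) : ∃ y, LinearIndependent F ![x, y] ∧ U = span F {x, y} := by
  have : Module.Finite F U := Module.finite_of_finrank_pos (by omega)
  have : ∃ y ∈ U, y ∉ span F {x} := by
    by_contra! h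
    have := finrank_mono (R := F) (show U ≤ span F {x} from h)
    rw [finrank_span_singleton hx0] at this
    omega
  obtain ⟨y, hy, hyx⟩ := this
  have hi : LinearIndependent F ![x, y] := by
    rw [LinearIndependent.pair_iff' hx0]
    intro a ha
    exact hyx (mem_span_singleton.2 ⟨a, ha⟩)
  exact ⟨y, hi, span_pair_eq_of_le hi hU hx hy⟩

lemma exists_dual_one_zero {x y : W} (h : LinearIndependent F ![x, y]) :
    ∃ φ : W →ₗ[F] F, φ x = 1 ∧ φ y = 0 := by
  have hx : x ∉ span F {y} := by
    intro hx
    obtain ⟨c, hc⟩ := mem_span_singleton.1 hx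
    have := (LinearIndependent.pair_iff.1 h) 1 (-c) (by rw [← hc]; module)
    simp at this
  obtain ⟨f, hf, hle⟩ := exists_le_ker_of_notMem hx
  refine ⟨(f x)⁻¹ • f, by simp [hf], ?_⟩
  have : f y = 0 := hle (mem_span_singleton_self y)
  simp [this]

lemma exists_dual_pair {x y : W} (h : LinearIndependent F ![x, y]) :
    ∃ φ ψ : W →ₗ[F] F, φ x = 1 ∧ φ y = 0 ∧ ψ x = 0 ∧ ψ y = 1 := by
  obtain ⟨φ, h1, h2⟩ := exists_dual_one_zero h
  obtain ⟨ψ, h3, h4⟩ := exists_dual_one_zero (LinearIndependent.pair_symm_iff.1 h)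
  exact ⟨φ, ψ, h1, h2, h4, h3⟩

end LinearAlgebra

/-! ### The veronesean map, its polarization and the nuclei of conics -/

section VeroneseAlgebra

variable {F : Type*} [Field F] {n : ℕ}

lemma veroneseVec_smul (c : F) (x : Fin n → F) :
    veroneseVec (c • x) = (c * c) • veroneseVec x := by
  ext p; simp [veroneseVec]; ring

lemma veronese_span_singleton (x : Fin n → F) :
    veronese (span F {x}) = span F {veroneseVec x} := by
  refine le_antisymm (span_le.2 ?_) (span_mono ?_)
  · rintro _ ⟨u, hu, rfl⟩
    obtain ⟨c, rfl⟩ := mem_span_singleton.1 hu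
    rw [veroneseVec_smul]
    exact smul_mem _ _ (mem_span_singleton_self _)
  · rintro _ rfl
    exact ⟨x, mem_span_singleton_self x, rfl⟩

/-- A product of two linear forms is a quadratic form, hence the pullback of a linear functional
along the veronesean. These functionals are the test vectors for almost every independence or
non-membership argument in V^⊗. -/
lemma exists_productForm (φ ψ : (Fin n → F) →ₗ[F] F) :
    ∃ Q : VeroneseSpace F n →ₗ[F] F, ∀ x, Q (veroneseVec x) = φ x * ψ x := by
  -- The double sum runs over ordered pairs; `min` and `max` sort each pair into an index of V^⊗.
  refine ⟨∑ i, ∑ j, (φ (Pi.single i 1) * ψ (Pi.single j 1)) •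
    (LinearMap.proj ⟨(min i j, max i j), min_le_max⟩ : VeroneseSpace F n →ₗ[F] F), fun x => ?_⟩
  rw [LinearMap.pi_apply_eq_sum_univ φ x, LinearMap.pi_apply_eq_sum_univ ψ x,
    Finset.sum_mul_sum]
  simp only [LinearMap.sum_apply, LinearMap.smul_apply, LinearMap.proj_apply, veroneseVec,
    smul_eq_mul]
  refine Finset.sum_congr rfl fun i _ => Finset.sum_congr rfl fun j _ => ?_
  have : x (min i j) * x (max i j) = x i * x j := by
    rcases le_total i j with h | h <;> simp [h, mul_comm]
  have hs : ∀ k : Fin n, (fun l => if k = l then (1 : F) else 0) = Pi.single k 1 := by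
    intro k; ext l; simp [Pi.single_apply, eq_comm]
  rw [this, hs, hs]
  ring

/-- The polarization of the quadratic veronesean map. -/
def veronesePolar : (Fin n → F) →ₗ[F] (Fin n → F) →ₗ[F] VeroneseSpace F n :=
  LinearMap.mk₂ F (fun x y p => x p.1.1 * y p.1.2 + y p.1.1 * x p.1.2)
    (fun x y z => by ext p; simp; ring) (fun c x y => by ext p; simp; ring)
    (fun x y z => by ext p; simp; ring) (fun c x y => by ext p; simp; ring)

lemma veronesePolar_apply (x y : Fin n → F) (p) :
    veronesePolar x y p = x p.1.1 * y p.1.2 + y p.1.1 * x p.1.2 := rfl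

lemma veroneseVec_add (x y : Fin n → F) :
    veroneseVec (x + y) = veroneseVec x + veroneseVec y + veronesePolar x y := by
  ext p; simp [veroneseVec, veronesePolar_apply]; ring

lemma veronesePolar_comm (x y : Fin n → F) : veronesePolar x y = veronesePolar y x := by
  ext p; simp [veronesePolar_apply]; ring

lemma map_veronesePolar {Q : VeroneseSpace F n →ₗ[F] F} {φ ψ : (Fin n → F) →ₗ[F] F}
    (hQ : ∀ x, Q (veroneseVec x) = φ x * ψ x) (x y : Fin n → F) :
    Q (veronesePolar x y) = φ x * ψ y + φ y * ψ x := by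
  have := hQ (x + y)
  rw [veroneseVec_add, map_add, map_add, hQ, hQ, map_add, map_add] at this
  linear_combination this

/-- The projection of `V^⊗` on the coordinates indexed by the pairs `(i, i)`. -/
def diagonal : VeroneseSpace F n →ₗ[F] (Fin n → F) :=
  LinearMap.pi fun i => LinearMap.proj ⟨(i, i), le_rfl⟩

lemma diagonal_apply (z : VeroneseSpace F n) (i) : diagonal z i = z ⟨(i, i), le_rfl⟩ := rfl

lemma diagonal_veroneseVec (x : Fin n → F) (i) : diagonal (veroneseVec x) i = x i * x i := rfl

lemma veroneseImage_eq (U : Submodule F (Fin n → F)) :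
    veroneseImage U = {c | ∃ u ∈ U, u ≠ 0 ∧ c = span F {veroneseVec u}} := by
  ext c; constructor
  · rintro ⟨p, hp, hpU, rfl⟩
    obtain ⟨u, hu, rfl⟩ := exists_eq_span_singleton hp
    exact ⟨u, hpU (mem_span_singleton_self u), hu, veronese_span_singleton u⟩
  · rintro ⟨u, hu, hu0, rfl⟩
    exact ⟨span F {u}, finrank_span_singleton hu0, by rwa [span_singleton_le_iff_mem],
      (veronese_span_singleton u).symm⟩

lemma veroneseVec_smul_add_smul (a b : F) (x y : Fin n → F) :
    veroneseVec (a • x + b • y) =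
      (a * a) • veroneseVec x + (b * b) • veroneseVec y + (a * b) • veronesePolar x y := by
  rw [veroneseVec_add, veroneseVec_smul, veroneseVec_smul]
  simp [smul_smul, mul_comm]

/-- If φ, ψ are dual to x, y, then φ², ψ² and φψ read off the three coefficients. -/
lemma veronese_relation {x y : Fin n → F} (h : LinearIndependent F ![x, y]) {a b c : F}
    (h0 : a • veroneseVec x + b • veroneseVec y + c • veronesePolar x y = 0) :
    a = 0 ∧ b = 0 ∧ c = 0 := by
  obtain ⟨φ, ψ, h1, h2, h3, h4⟩ := exists_dual_pair h
  have key : ∀ φ ψ : (Fin n → F) →ₗ[F] F, a * (φ x * ψ x) + b * (φ y * ψ y) +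
      c * (φ x * ψ y + φ y * ψ x) = 0 := by
    intro φ ψ
    obtain ⟨Q, hQ⟩ := exists_productForm φ ψ
    have := congrArg Q h0
    simpa [hQ, map_veronesePolar hQ] using this
  have e1 := key φ φ
  have e2 := key ψ ψ
  have e3 := key φ ψ
  simp only [h1, h2, h3, h4] at e1 e2 e3
  exact ⟨by simpa using e1, by simpa using e2, by simpa using e3⟩

lemma linearIndependent_veronese {x y : Fin n → F} (h : LinearIndependent F ![x, y]) :
    LinearIndependent F ![veroneseVec x, veroneseVec y, veronesePolar x y] := by
  rw [Fintype.linearIndependent_iff]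
  intro g hg
  have := veronese_relation h (a := g 0) (b := g 1) (c := g 2)
    (by simpa [Fin.sum_univ_three] using hg)
  intro i; fin_cases i
  exacts [this.1, this.2.1, this.2.2]

/-- The three points given by x, y and x + y already yield the polarization, so this needs no
assumption on the size of the field. -/
lemma sSup_veroneseImage (x y : Fin n → F) :
    sSup (veroneseImage (span F {x, y})) =
      span F {veroneseVec x, veroneseVec y, veronesePolar x y} := by
  rw [veroneseImage_eq]
  apply le_antisymm
  · apply sSup_le
    rintro _ ⟨u, hu, -, rfl⟩
    obtain ⟨a, b, rfl⟩ := mem_span_pair.1 hu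
    rw [span_singleton_le_iff_mem, veroneseVec_smul_add_smul]
    exact mem_span_triple.2 ⟨_, _, _, rfl⟩
  · have key : ∀ u ∈ span F {x, y}, veroneseVec u ∈
        sSup {c | ∃ u ∈ span F {x, y}, u ≠ 0 ∧ c = span F {veroneseVec u}} := by
      intro u hu
      by_cases hu0 : u = 0
      · have : veroneseVec u = 0 := by subst hu0; ext p; simp [veroneseVec]
        rw [this]; exact zero_mem _
      · refine (le_sSup ?_ : span F {veroneseVec u} ≤ _) (mem_span_singleton_self _)
        exact ⟨u, hu, hu0, rfl⟩
    have hx := key x (subset_span (by simp))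
    have hy := key y (subset_span (by simp))
    have hxy := key (x + y) (add_mem (subset_span (by simp)) (subset_span (by simp)))
    rw [span_le]
    rintro _ (rfl | rfl | rfl)
    · exact hx
    · exact hy
    · have : veronesePolar x y = veroneseVec (x + y) - veroneseVec x - veroneseVec y := by
        rw [veroneseVec_add]; abel
      rw [this]
      exact sub_mem (sub_mem hxy hx) hy

lemma finrank_sSup_veroneseImage {U : Submodule F (Fin n → F)} (hU : finrank F U = 2) :
    finrank F (sSup (veroneseImage U) : Submodule F _) = 3 := by
  obtain ⟨x, y, h, rfl⟩ := exists_eq_span_pair hU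
  rw [sSup_veroneseImage]
  have := finrank_span_eq_card (linearIndependent_veronese h)
  rw [Matrix.range_cons, Matrix.range_cons, Matrix.range_cons, Matrix.range_empty,
    Set.union_empty] at this
  exact this

/-- The coefficient of η(y) in η(ax + by) is b², so the point lies on this line only if b = 0. -/
lemma isTangentLine_veroneseImage {x y : Fin n → F} (h : LinearIndependent F ![x, y]) :
    IsTangentLine (veroneseImage (span F {x, y})) (span F {veroneseVec x})
      (span F {veroneseVec x, veronesePolar x y}) := by
  refine ⟨finrank_span_pair ?_, ?_, ?_, ?_⟩
  · rw [LinearIndependent.pair_iff]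
    intro s t hst
    have := veronese_relation h (a := s) (b := 0) (c := t) (by simpa using hst)
    exact ⟨this.1, this.2.2⟩
  · rw [sSup_veroneseImage]
    apply span_mono
    rintro _ (rfl | rfl) <;> simp
  · rw [veroneseImage_eq]
    exact ⟨x, subset_span (by simp), h.ne_zero 0, rfl⟩
  · rw [veroneseImage_eq]
    rintro _ ⟨u, hu, hu0, rfl⟩
    constructor
    · intro hle
      rw [span_singleton_le_iff_mem] at hle
      obtain ⟨a, b, rfl⟩ := mem_span_pair.1 hu
      obtain ⟨c, d, hcd⟩ := mem_span_pair.1 hle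
      rw [veroneseVec_smul_add_smul] at hcd
      have := veronese_relation h (a := a * a - c) (b := b * b) (c := a * b - d)
        (by rw [sub_smul, sub_smul]; linear_combination (exp := 1) -hcd)
      have hb : b = 0 := by simpa using this.2.1
      subst hb
      have ha : a ≠ 0 := by rintro rfl; simp at hu0
      rw [zero_smul, add_zero, veroneseVec_smul]
      exact span_singleton_smul_eq (IsUnit.mk0 _ (mul_ne_zero ha ha)) _
    · intro he
      rw [he]
      exact span_mono (by simp)

/-- Uniqueness of the tangent at η(x): any other line of the plane through η(x) meets the conic a
second time. -/
lemma veronesePolar_mem_of_isTangentLine {x y : Fin n → F} (h : LinearIndependent F ![x, y])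
    {t : Submodule F (VeroneseSpace F n)}
    (ht : IsTangentLine (veroneseImage (span F {x, y})) (span F {veroneseVec x}) t) :
    veronesePolar x y ∈ t := by
  obtain ⟨hdim, hle, hc, htan⟩ := ht
  have hxt : veroneseVec x ∈ t := by
    rw [← span_singleton_le_iff_mem]; exact (htan _ hc).2 rfl
  have hx0 : veroneseVec x ≠ 0 := by
    intro h0
    exact one_ne_zero (veronese_relation h (a := 1) (b := 0) (c := 0) (by simp [h0])).1
  obtain ⟨z, hi, rfl⟩ := exists_eq_span_pair_of_mem hdim hxt hx0
  have hz : z ∈ span F {veroneseVec x, z} := subset_span (by simp)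
  have hz' := hle hz
  rw [sSup_veroneseImage] at hz'
  obtain ⟨a, b, c, rfl⟩ := mem_span_triple.1 hz'
  set t := span F {veroneseVec x, a • veroneseVec x + b • veroneseVec y + c • veronesePolar x y}
  have hz2 : b • veroneseVec y + c • veronesePolar x y ∈ t := by
    have := sub_mem hz (smul_mem _ a hxt)
    convert this using 1; abel
  by_cases hb : b = 0
  · subst hb
    rw [zero_smul, zero_add] at hz2
    by_cases hc0 : c = 0
    · subst hc0
      have := (LinearIndependent.pair_iff.1 hi) a (-1) (by simp)
      simp at this
    · exact (smul_mem_iff _ hc0).1 hz2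
  · exfalso
    -- The second intersection: modulo η(x), the vector η((c/b)x + y) equals b⁻¹(bη(y) + cπ(x, y)).
    set u : Fin n → F := (b⁻¹ * c) • x + (1 : F) • y with hu
    have huU : u ∈ span F {x, y} := mem_span_pair.2 ⟨_, _, rfl⟩
    have hu0 : u ≠ 0 := by
      intro h0
      exact one_ne_zero ((LinearIndependent.pair_iff.1 h) _ _ h0).2
    have hmem : veroneseVec u ∈ t := by
      have := add_mem (smul_mem _ ((b⁻¹ * c) * (b⁻¹ * c)) hxt) (smul_mem _ b⁻¹ hz2)
      convert this using 1
      rw [hu, veroneseVec_smul_add_smul, smul_add, smul_smul, smul_smul, inv_mul_cancel₀ hb]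
      module
    have := (htan (span F {veroneseVec u}) (by
      rw [veroneseImage_eq]; exact ⟨u, huU, hu0, rfl⟩)).1 (by
        rwa [span_singleton_le_iff_mem])
    have hmem2 : veroneseVec u ∈ span F {veroneseVec x} := by
      rw [← this]; exact mem_span_singleton_self _
    obtain ⟨d, hd⟩ := mem_span_singleton.1 hmem2
    rw [hu, veroneseVec_smul_add_smul] at hd
    have := veronese_relation h (a := (b⁻¹ * c) * (b⁻¹ * c) - d) (b := 1 * 1) (c := b⁻¹ * c * 1)
      (by rw [sub_smul]; linear_combination (exp := 1) -hd)
    simp at this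

variable [CharP F 2]

lemma veronesePolar_self (x : Fin n → F) : veronesePolar x x = 0 := by
  ext p; simp [veronesePolar_apply, CharTwo.add_self_eq_zero]

lemma diagonal_veronesePolar (x y : Fin n → F) : diagonal (veronesePolar x y) = 0 := by
  ext i; simp [diagonal_apply, veronesePolar_apply, mul_comm, CharTwo.add_self_eq_zero]

lemma veronesePolar_smul_add_smul (a b c d : F) (x y : Fin n → F) :
    veronesePolar (a • x + b • y) (c • x + d • y) = (a * d + b * c) • veronesePolar x y := by
  simp only [map_add, map_smul, LinearMap.add_apply, LinearMap.smul_apply, veronesePolar_self,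
    veronesePolar_comm y x]
  module

lemma veronesePolar_eq_zero_iff {x y : Fin n → F} :
    veronesePolar x y = 0 ↔ ¬ LinearIndependent F ![x, y] := by
  constructor
  · intro h hi
    have := (veronese_relation hi (a := 0) (b := 0) (c := 1) (by simp [h])).2.2
    exact one_ne_zero this
  · intro h
    rw [LinearIndependent.pair_iff] at h
    push Not at h
    obtain ⟨s, t, hst, hne⟩ := h
    by_cases hs : s = 0
    · have ht := hne hs
      subst hs
      have : y = 0 := by simpa [ht] using hst
      simp [this]
    · have : x = (- (s⁻¹ * t)) • y := by
        have : s⁻¹ • (s • x + t • y) = 0 := by rw [hst, smul_zero]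
        rw [smul_add, smul_smul, inv_mul_cancel₀ hs, one_smul, smul_smul] at this
        rw [neg_smul]; exact eq_neg_of_add_eq_zero_left this
      rw [this, map_smul, LinearMap.smul_apply, veronesePolar_self, smul_zero]

/-- If `x ∧ y = u ∧ v ≠ 0` then `u` lies on the line `⟨x, y⟩`. -/
lemma mem_span_pair_of_veronesePolar_eq {x y u v : Fin n → F}
    (h : veronesePolar x y = veronesePolar u v) (hne : veronesePolar u v ≠ 0) :
    u ∈ span F {x, y} := by
  by_contra hu
  obtain ⟨φ, hφ, hle⟩ := exists_le_ker_of_notMem hu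
  have hx : φ x = 0 := hle (subset_span (by simp))
  have hy : φ y = 0 := hle (subset_span (by simp))
  have hi : LinearIndependent F ![u, v] := by
    by_contra hi; exact hne (veronesePolar_eq_zero_iff.2 hi)
  -- With ψ(u) = 0 and ψ(v) = 1, the functional of φψ takes the value φ(u) ≠ 0 on π(u, v), whereas
  -- it kills π(x, y) because φ vanishes on x and y.
  obtain ⟨-, ψ, -, -, h3, h4⟩ := exists_dual_pair hi
  obtain ⟨Q, hQ⟩ := exists_productForm φ ψ
  have := congrArg Q h
  rw [map_veronesePolar hQ, map_veronesePolar hQ, hx, hy, h3, h4] at this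
  exact hφ (by simpa using this.symm)

lemma span_veronesePolar_eq {x y u v : Fin n → F} (h : LinearIndependent F ![u, v])
    (hu : u ∈ span F {x, y}) (hv : v ∈ span F {x, y}) :
    span F {veronesePolar u v} = span F {veronesePolar x y} := by
  obtain ⟨a, b, rfl⟩ := mem_span_pair.1 hu
  obtain ⟨c, d, rfl⟩ := mem_span_pair.1 hv
  have hne : veronesePolar (a • x + b • y) (c • x + d • y) ≠ 0 := by
    rw [Ne, veronesePolar_eq_zero_iff, not_not]; exact h
  rw [veronesePolar_smul_add_smul] at hne ⊢
  exact span_singleton_smul_eq (IsUnit.mk0 _ (left_ne_zero_of_smul hne)) _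

/-- The tangents at η(x) and η(y) meet only in ⟨π(x, y)⟩. Conversely, a change of basis of the line
multiplies the alternating π by the determinant, so the tangent at every point of the conic passes
through the same point. -/
lemma lineNucleus_span_pair {x y : Fin n → F} (h : LinearIndependent F ![x, y]) :
    lineNucleus (span F {x, y}) = span F {veronesePolar x y} := by
  apply le_antisymm
  · intro z hz
    rw [lineNucleus, nucleus, mem_sInf] at hz
    have h1 := hz _ ⟨_, isTangentLine_veroneseImage h⟩
    have h2 := hz (span F {veroneseVec y, veronesePolar y x}) ⟨_, by
      rw [Set.pair_comm x y]
      exact isTangentLine_veroneseImage (LinearIndependent.pair_symm_iff.1 h)⟩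
    rw [veronesePolar_comm y x] at h2
    obtain ⟨a, b, rfl⟩ := mem_span_pair.1 h1
    obtain ⟨c, d, hcd⟩ := mem_span_pair.1 h2
    have := veronese_relation h (a := a) (b := -c) (c := b - d)
      (by rw [sub_smul, neg_smul]; linear_combination (exp := 1) -hcd)
    rw [this.1, zero_smul, zero_add]
    exact smul_mem _ _ (mem_span_singleton_self _)
  · rw [span_singleton_le_iff_mem, lineNucleus, nucleus, mem_sInf]
    rintro t ⟨c, ht⟩
    have hc := ht.2.2.1
    rw [veroneseImage_eq] at hc
    obtain ⟨u, hu, hu0, rfl⟩ := hc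
    obtain ⟨v, hi, he⟩ := exists_eq_span_pair_of_mem (finrank_span_pair h) hu hu0
    have hv : v ∈ span F {x, y} := by rw [he]; exact subset_span (by simp)
    rw [he] at ht
    have := veronesePolar_mem_of_isTangentLine hi ht
    rw [← span_singleton_le_iff_mem] at this ⊢
    rwa [← span_veronesePolar_eq hi hu hv]

lemma finrank_lineNucleus {U : Submodule F (Fin n → F)} (hU : finrank F U = 2) :
    finrank F (lineNucleus U) = 1 := by
  obtain ⟨x, y, h, rfl⟩ := exists_eq_span_pair hU
  rw [lineNucleus_span_pair h]
  apply finrank_span_singleton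
  rw [Ne, veronesePolar_eq_zero_iff, not_not]; exact h

lemma veronesePolar_mem_lineNucleus {U : Submodule F (Fin n → F)} (hU : finrank F U = 2)
    {x y : Fin n → F} (hx : x ∈ U) (hy : y ∈ U) : veronesePolar x y ∈ lineNucleus U := by
  by_cases h : LinearIndependent F ![x, y]
  · rw [span_pair_eq_of_le h hU hx hy, lineNucleus_span_pair h]
    exact mem_span_singleton_self _
  · rw [veronesePolar_eq_zero_iff.2 h]; exact zero_mem _

lemma veronesePolar_mem_nucleusSpan (x y : Fin n → F) :
    veronesePolar x y ∈ nucleusSpan F n := by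
  by_cases h : LinearIndependent F ![x, y]
  · have hU := finrank_span_pair h
    exact (le_iSup₂_of_le (span F {x, y}) hU le_rfl : _ ≤ nucleusSpan F n)
      (veronesePolar_mem_lineNucleus hU (subset_span (by simp)) (subset_span (by simp)))
  · rw [veronesePolar_eq_zero_iff.2 h]; exact zero_mem _

lemma nucleusSpan_le {S : Submodule F (VeroneseSpace F n)}
    (hS : ∀ x y, veronesePolar x y ∈ S) : nucleusSpan F n ≤ S := by
  refine iSup₂_le fun U hU => ?_
  obtain ⟨x, y, h, rfl⟩ := exists_eq_span_pair hU
  rw [lineNucleus_span_pair h, span_singleton_le_iff_mem]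
  exact hS x y

lemma sum_smul_veronesePolar {z : VeroneseSpace F n} (hz : diagonal z = 0) :
    z = ∑ p : {p : Fin n × Fin n // p.1 ≤ p.2},
      z p • veronesePolar (Pi.single p.1.1 1) (Pi.single p.1.2 1) := by
  ext q
  rw [Finset.sum_apply, Finset.sum_eq_single q]
  · by_cases hq : q.1.1 = q.1.2
    · have h0 : z q = 0 := by
        have := congrFun hz q.1.1
        rw [diagonal_apply, Pi.zero_apply] at this
        rw [← this]
        exact congrArg z (Subtype.ext (Prod.ext rfl hq.symm))
      simp [h0]
    · simp [veronesePolar_apply, hq]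
  · rintro p - hpq
    by_cases hp : p.1.1 = p.1.2
    · simp [hp, veronesePolar_self]
    · have h1 : ¬ (q.1.1 = p.1.1 ∧ q.1.2 = p.1.2) := fun h =>
        hpq (Subtype.ext (Prod.ext h.1.symm h.2.symm))
      have h2 : ¬ (q.1.1 = p.1.2 ∧ q.1.2 = p.1.1) := fun h => by
        have hq := q.2
        have hp' := p.2
        rw [h.1, h.2] at hq
        exact hp (le_antisymm hp' hq)
      simp only [Pi.smul_apply, veronesePolar_apply, Pi.single_apply, smul_eq_mul]
      split_ifs <;> simp_all
  · simp

/-- In characteristic 2 the diagonal coordinates 2x_i y_i of a polarization vanish, while the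
polarizations of pairs of standard basis vectors give all the off-diagonal unit vectors. Thus N_H
becomes the kernel of an explicit linear map on H. -/
lemma nucleusSpan_eq_ker_diagonal : nucleusSpan F n = LinearMap.ker diagonal := by
  apply le_antisymm
  · exact nucleusSpan_le fun x y => diagonal_veronesePolar x y
  · intro z hz
    rw [sum_smul_veronesePolar hz]
    exact sum_mem fun p _ => smul_mem _ _ (veronesePolar_mem_nucleusSpan _ _)

end VeroneseAlgebra

/-! ### The embedding of the exterior square in V^⊗ -/

section Exterior

variable {F : Type*} [Field F] {n : ℕ}

lemma ιMulti_swap {V : Type*} [AddCommGroup V] [Module F V] [CharP F 2] (x y : V) :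
    exteriorPower.ιMulti F 2 ![y, x] = exteriorPower.ιMulti F 2 ![x, y] := by
  have h := (exteriorPower.ιMulti F 2).map_swap ![x, y] (i := 0) (j := 1) (by decide)
  have h2 : (![x, y] ∘ Equiv.swap (0 : Fin 2) 1) = ![y, x] := by
    ext i; fin_cases i <;> simp
  rw [h2] at h
  have h3 := two_smul F (exteriorPower.ιMulti F 2 ![x, y])
  rw [CharTwo.two_eq_zero (R := F), zero_smul] at h3
  rw [h, neg_eq_iff_add_eq_zero]
  exact h3.symm

/-- A left inverse of `wedgeToVeronese`. -/
noncomputable def veroneseToWedge : VeroneseSpace F n →ₗ[F] (⋀[F]^2 (Fin n → F)) :=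
  ∑ p : {p : Fin n × Fin n // p.1 ≤ p.2},
    (LinearMap.proj p).smulRight
      (exteriorPower.ιMulti F 2 ![(Pi.single p.1.1 1 : Fin n → F), Pi.single p.1.2 1])

lemma veroneseToWedge_single {i j : Fin n} (h : i < j) :
    veroneseToWedge (veronesePolar (Pi.single i (1 : F)) (Pi.single j 1)) =
      exteriorPower.ιMulti F 2 ![(Pi.single i 1 : Fin n → F), Pi.single j 1] := by
  rw [veroneseToWedge, LinearMap.sum_apply, Finset.sum_eq_single ⟨(i, j), h.le⟩]
  · simp [veronesePolar_apply, h.ne]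
  · rintro p - hp
    have h1 : ¬ (p.1.1 = i ∧ p.1.2 = j) := fun h =>
      hp (Subtype.ext (Prod.ext h.1 h.2))
    have h2 : ¬ (p.1.2 = i ∧ p.1.1 = j) := fun h' => by
      have hq := p.2
      rw [h'.1, h'.2] at hq
      exact absurd hq (not_le.2 h)
    simp only [LinearMap.smulRight_apply, LinearMap.proj_apply, veronesePolar_apply,
      Pi.single_apply]
    split_ifs <;> simp_all
  · simp

variable [CharP F 2]

/-- The polarization of the veronesean map, as an alternating map. -/
noncomputable def veroneseAlternating : (Fin n → F) [⋀^Fin 2]→ₗ[F] VeroneseSpace F n where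
  toFun v := veronesePolar (v 0) (v 1)
  map_update_add' := by
    intro inst v i x y
    obtain rfl := Subsingleton.elim inst (instDecidableEqFin 2)
    fin_cases i <;> simp
  map_update_smul' := by
    intro inst v i c x
    obtain rfl := Subsingleton.elim inst (instDecidableEqFin 2)
    fin_cases i <;> simp
  map_eq_zero_of_eq' := by
    intro v i j h hij
    have : v 0 = v 1 := by
      fin_cases i <;> fin_cases j <;> simp_all
    rw [this, veronesePolar_self]

/-- The linear map `V ∧ V → V^⊗` that sends `x ∧ y` to the polarization of the veronesean map. -/
noncomputable def wedgeToVeronese : (⋀[F]^2 (Fin n → F)) →ₗ[F] VeroneseSpace F n :=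
  exteriorPower.alternatingMapLinearEquiv veroneseAlternating

lemma wedgeToVeronese_ιMulti (x y : Fin n → F) :
    wedgeToVeronese (exteriorPower.ιMulti F 2 ![x, y]) = veronesePolar x y := by
  rw [wedgeToVeronese, exteriorPower.alternatingMapLinearEquiv_apply_ιMulti]
  rfl

/-- The left inverse need only be checked on e_i ∧ e_j with i ≠ j; when i > j the two factors are
exchanged, which costs no sign in characteristic 2. -/
lemma wedgeToVeronese_injective :
    Function.Injective (wedgeToVeronese : (⋀[F]^2 (Fin n → F)) →ₗ[F] VeroneseSpace F n) := by
  suffices h : veroneseToWedge ∘ₗ wedgeToVeronese =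
      (LinearMap.id : (⋀[F]^2 (Fin n → F)) →ₗ[F] _) from
    Function.LeftInverse.injective fun z => LinearMap.congr_fun h z
  apply exteriorPower.linearMap_ext
  refine Basis.ext_alternating (Pi.basisFun F (Fin n)) fun v hv => ?_
  have he : (fun i => Pi.basisFun F (Fin n) (v i)) =
      ![(Pi.single (v 0) 1 : Fin n → F), Pi.single (v 1) 1] := by
    ext i; fin_cases i <;> simp
  rw [he]
  simp only [LinearMap.compAlternatingMap_apply, LinearMap.comp_apply, LinearMap.id_apply,
    wedgeToVeronese_ιMulti]
  rcases lt_or_gt_of_ne (hv.ne (show (0 : Fin 2) ≠ 1 by decide)) with h | h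
  · exact veroneseToWedge_single h
  · rw [veronesePolar_comm, veroneseToWedge_single h, ιMulti_swap]

lemma map_pluecker {U : Submodule F (Fin n → F)} (hU : finrank F U = 2) :
    (pluecker U).map wedgeToVeronese = lineNucleus U := by
  apply le_antisymm
  · rw [pluecker, map_span, span_le]
    rintro _ ⟨_, ⟨x, hx, y, hy, rfl⟩, rfl⟩
    rw [wedgeToVeronese_ιMulti]
    exact veronesePolar_mem_lineNucleus hU hx hy
  · obtain ⟨x, y, h, rfl⟩ := exists_eq_span_pair hU
    rw [lineNucleus_span_pair h, span_singleton_le_iff_mem, ← wedgeToVeronese_ιMulti]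
    exact mem_map_of_mem (subset_span
      ⟨x, subset_span (by simp), y, subset_span (by simp), rfl⟩)

end Exterior

/-! ### Embeddings in the span of the image, and their transport along linear maps -/

section Embedding

variable {F W W' : Type*} [Field F] [AddCommMonoid W] [Module F W] [AddCommMonoid W'] [Module F W']

lemma map_lineSpan {P : Type*} (f : W →ₗ[F] W') (ε : P → Submodule F W) (l : Set P) :
    (lineSpan ε l).map f = lineSpan (fun p => (ε p).map f) l := by
  simp only [lineSpan, Submodule.map_iSup]

lemma map_imageSpan {P : Type*} (f : W →ₗ[F] W') (ε : P → Submodule F W) :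
    (imageSpan ε).map f = imageSpan (fun p => (ε p).map f) := by
  simp only [imageSpan, Submodule.map_iSup]

lemma map_restrictToSpan {P : Type*} (ε : P → Submodule F W) (p : P) :
    (restrictToSpan ε p).map (imageSpan ε).subtype = ε p := by
  rw [restrictToSpan, submoduleOf, map_comap_subtype, inf_eq_right]
  exact le_iSup ε p

lemma map_lineSpan_restrictToSpan {P : Type*} (ε : P → Submodule F W) (l : Set P) :
    (lineSpan (restrictToSpan ε) l).map (imageSpan ε).subtype = lineSpan ε l := by
  simp only [map_lineSpan, map_restrictToSpan]

lemma finrank_map_of_injective {f : W →ₗ[F] W'} (hf : Function.Injective f) (p : Submodule F W) :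
    finrank F (p.map f) = finrank F p :=
  (equivMapOfInjective f hf p).finrank_eq.symm

/-- `ε` is a `d`-embedding of `Γ` in the projective space of the span of its image. -/
structure IsLocalEmbeddingInSpan (Γ : PointLineGeometry) (d : ℕ) (ε : Γ.Pt → Submodule F W) :
    Prop where
  pos : 0 < d
  point : ∀ p, finrank F (ε p) = 1
  injective : Function.Injective ε
  line_dim : ∀ l ∈ Γ.lines, finrank F (lineSpan ε l) = d + 1
  line_full : ∀ l ∈ Γ.lines, ∀ p, ε p ≤ lineSpan ε l → p ∈ l

/-- Used in two ways: for the inclusion of the span of the image, and to pass from the nucleus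
embedding back to the Grassmann embedding. -/
lemma IsLocalEmbeddingInSpan.of_map {Γ : PointLineGeometry} {d : ℕ} {f : W →ₗ[F] W'}
    (hf : Function.Injective f) {ε : Γ.Pt → Submodule F W}
    (h : IsLocalEmbeddingInSpan Γ d (fun p => (ε p).map f)) : IsLocalEmbeddingInSpan Γ d ε where
  pos := h.pos
  point p := by rw [← finrank_map_of_injective hf, h.point]
  injective p q hpq := h.injective (congrArg (map f) hpq)
  line_dim l hl := by rw [← finrank_map_of_injective hf, map_lineSpan, h.line_dim l hl]
  line_full l hl p hp := h.line_full l hl p (by rw [← map_lineSpan]; exact map_mono hp)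

lemma IsLocalEmbeddingInSpan.restrictToSpan {Γ : PointLineGeometry} {d : ℕ}
    {ε : Γ.Pt → Submodule F W} (h : IsLocalEmbeddingInSpan Γ d ε) :
    IsLocalEmbedding Γ d (restrictToSpan ε) := by
  have h' : IsLocalEmbeddingInSpan Γ d (ConicNuclei.restrictToSpan ε) := by
    apply IsLocalEmbeddingInSpan.of_map (subtype_injective (imageSpan ε))
    simpa only [map_restrictToSpan] using h
  refine ⟨h'.pos, h'.point, h'.injective, h'.line_dim, h'.line_full, ?_⟩
  apply map_injective_of_injective (subtype_injective (imageSpan ε))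
  rw [map_imageSpan, Submodule.map_top, range_subtype]
  simp only [map_restrictToSpan]

lemma definesQuotient_restrictToSpan {Γ : PointLineGeometry} {d k : ℕ}
    {ε : Γ.Pt → Submodule F W} {K : Submodule F W} (hK : K ≤ imageSpan ε)
    (disjoint_pair : ∀ p q, (ε p ⊔ ε q) ⊓ K = ⊥)
    (disjoint_line : ∀ l ∈ Γ.lines, ∀ p, p ∉ l → ε p ⊓ (lineSpan ε l ⊔ K) = ⊥) (lt : k < d)
    (inf_line : ∀ l ∈ Γ.lines, finrank F (K ⊓ lineSpan ε l : Submodule F W) = k) :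
    DefinesQuotient Γ d k (restrictToSpan ε) (K.submoduleOf (imageSpan ε)) := by
  have hinj := subtype_injective (imageSpan ε)
  have hmap : (K.submoduleOf (imageSpan ε)).map (imageSpan ε).subtype = K := by
    rw [submoduleOf, map_comap_subtype, inf_eq_right]; exact hK
  refine ⟨fun p q => ?_, fun l hl p hp => ?_, lt, fun l hl => ?_⟩
  · apply map_injective_of_injective hinj
    rw [map_inf _ hinj, Submodule.map_sup, map_restrictToSpan, map_restrictToSpan, hmap,
      Submodule.map_bot, disjoint_pair]
  · apply map_injective_of_injective hinj
    rw [map_inf _ hinj, Submodule.map_sup, map_restrictToSpan, map_lineSpan_restrictToSpan, hmap,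
      Submodule.map_bot, disjoint_line l hl p hp]
  · rw [← finrank_map_of_injective hinj, map_inf _ hinj, map_lineSpan_restrictToSpan, hmap,
      inf_line l hl]

/-- Restricting to the spans, an embedding is isomorphic to its image under an injective linear
map. -/
lemma embeddingIso_restrictToSpan_map {P : Type*} {f : W →ₗ[F] W'} (hf : Function.Injective f)
    {ε : P → Submodule F W} {ε' : P → Submodule F W'} (h : ∀ p, (ε p).map f = ε' p) :
    EmbeddingIso (restrictToSpan ε') (restrictToSpan ε) := by
  have hs : (imageSpan ε).map f = imageSpan ε' := by
    rw [map_imageSpan]; simp only [h]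
  let e : imageSpan ε ≃ₗ[F] imageSpan ε' :=
    (equivMapOfInjective f hf (imageSpan ε)).trans (LinearEquiv.ofEq _ _ hs)
  have he : ∀ x, (e x : W') = f x := fun x => rfl
  -- The required isomorphism runs from the image back to the source, hence the inverse of `e`; the
  -- field automorphism is trivial.
  refine ⟨RingEquiv.refl F, e.symm.toLinearMap, e.symm.bijective, fun p => ?_⟩
  ext x
  change x ∈ (restrictToSpan ε' p).map e.symm.toLinearMap ↔ _
  simp only [mem_map, LinearEquiv.coe_coe]
  constructor
  · rintro ⟨y, hy, rfl⟩
    change (e.symm y : W) ∈ ε p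
    have hy' : (y : W') ∈ ε' p := hy
    rw [← h, ← e.apply_symm_apply y, he] at hy'
    obtain ⟨z, hz, hzy⟩ := hy'
    rw [← hf hzy]; exact hz
  · intro hx
    refine ⟨e x, ?_, e.symm_apply_apply x⟩
    change (e x : W') ∈ ε' p
    rw [he, ← h]
    exact mem_map_of_mem hx

end Embedding

/-! ### Quotients of embeddings -/

section Quotient

variable {F W : Type*} [Field F] [AddCommGroup W] [Module F W]

lemma finrank_map_mkQ {S K : Submodule F W} [Module.Finite F S] :
    finrank F (S.map K.mkQ) + finrank F (K ⊓ S : Submodule F W) = finrank F S := by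
  have h := LinearMap.finrank_range_add_finrank_ker (K.mkQ.domRestrict S)
  rw [LinearMap.range_domRestrict] at h
  suffices hk : (LinearMap.ker (K.mkQ.domRestrict S)).map S.subtype = K ⊓ S by
    rw [← h, ← hk, finrank_map_of_injective (subtype_injective S)]
  ext z
  simp only [mem_inf, mem_map, LinearMap.mem_ker, LinearMap.domRestrict_apply, mkQ_apply,
    Quotient.mk_eq_zero, subtype_apply, Subtype.exists, exists_and_right, exists_eq_right]
  tauto

lemma map_mkQ_le_map_mkQ_iff {p S K : Submodule F W} :
    p.map K.mkQ ≤ S.map K.mkQ ↔ p ≤ S ⊔ K := by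
  rw [map_le_iff_le_comap, comap_map_mkQ, sup_comm]

/-- The quotient of a `d`-embedding by a subspace that defines a `k`-quotient is a
`(d - k)`-embedding. -/
lemma IsLocalEmbedding.quotient {Γ : PointLineGeometry} {d k : ℕ}
    {ε : Γ.Pt → Submodule F W} (hε : IsLocalEmbedding Γ d ε) {K : Submodule F W}
    (hK : DefinesQuotient Γ d k ε K) :
    IsLocalEmbedding Γ (d - k) (quotientEmbedding ε K) where
  pos := Nat.sub_pos_of_lt hK.lt
  point p := by
    have : Module.Finite F (ε p) := Module.finite_of_finrank_pos (by rw [hε.point]; norm_num)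
    have h := finrank_map_mkQ (S := ε p) (K := K)
    have h2 := hK.disjoint_pair p p
    rw [sup_idem, inf_comm] at h2
    rw [h2, finrank_bot, hε.point] at h
    exact h
  injective p q h := by
    apply hε.injective
    have hle : ε p ≤ ε q ⊔ K := map_mkQ_le_map_mkQ_iff.1 h.le
    have hpq : ε p ≤ ε q := by
      intro x hx
      obtain ⟨y, hy, k, hk, rfl⟩ := mem_sup.1 (hle hx)
      -- The error term is the difference of a vector of ε(p) and one of ε(q), so the disjointness
      -- from joins forces it to vanish.
      have : k ∈ (ε p ⊔ ε q) ⊓ K := by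
        refine ⟨?_, hk⟩
        have := sub_mem (mem_sup_left hx : _ ∈ ε p ⊔ ε q) (mem_sup_right hy)
        simpa using this
      rw [hK.disjoint_pair, mem_bot] at this
      rw [this, add_zero]; exact hy
    have : Module.Finite F (ε q) := Module.finite_of_finrank_pos (by rw [hε.point]; norm_num)
    exact eq_of_le_of_finrank_eq hpq (by rw [hε.point, hε.point])
  line_dim l hl := by
    have : Module.Finite F (lineSpan ε l) :=
      Module.finite_of_finrank_pos (by rw [hε.line_dim l hl]; omega)
    have h := finrank_map_mkQ (S := lineSpan ε l) (K := K)
    rw [hK.inf_line l hl, hε.line_dim l hl, map_lineSpan] at h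
    have := hK.lt
    change finrank F (lineSpan (fun p => (ε p).map K.mkQ) l) = _
    omega
  line_full l hl p h := by
    by_contra hp
    have h1 : (ε p).map K.mkQ ≤ (lineSpan ε l).map K.mkQ := by
      rw [map_lineSpan]; exact h
    have h2 := hK.disjoint_line l hl p hp
    rw [inf_eq_left.2 (map_mkQ_le_map_mkQ_iff.1 h1)] at h2
    have := hε.point p
    rw [h2, finrank_bot] at this
    omega
  span_top := by
    change imageSpan (fun p => (ε p).map K.mkQ) = ⊤
    rw [← map_imageSpan, hε.span_top, Submodule.map_top, range_mkQ]

end Quotient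

/-! ### Non-singular quadratic forms of Witt index 2 and their normal form -/

section QuadraticForms

universe u

variable {F V : Type u} [Field F] [AddCommGroup V] [Module F V] (χ : QuadraticForm F V)

lemma quadraticForm_smul (c : F) (x : V) : χ (c • x) = c * c * χ x := by
  rw [QuadraticMap.map_smul, smul_eq_mul]

lemma quadraticForm_add (x y : V) : χ (x + y) = χ x + χ y + χ.polarBilin x y := by
  rw [QuadraticMap.polarBilin_apply_apply]; exact QuadraticMap.map_add χ x y

lemma polarBilin_comm (x y : V) : χ.polarBilin x y = χ.polarBilin y x := by
  simp only [QuadraticMap.polarBilin_apply_apply, QuadraticMap.polar_comm χ x y]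

lemma polarBilin_self [CharP F 2] (x : V) : χ.polarBilin x x = 0 := by
  rw [QuadraticMap.polarBilin_apply_apply, QuadraticMap.polar_self, two_smul,
    CharTwo.add_self_eq_zero]

variable {χ}

lemma IsTotallySingular.polarBilin_eq_zero {U : Submodule F V} (hU : IsTotallySingular χ U) {x y : V}
    (hx : x ∈ U) (hy : y ∈ U) : χ.polarBilin x y = 0 := by
  have := quadraticForm_add χ x y
  rw [hU _ hx, hU _ hy, hU _ (add_mem hx hy)] at this
  simpa using this.symm

lemma isTotallySingular_span_singleton {x : V} (hx : χ x = 0) :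
    IsTotallySingular χ (span F {x}) := by
  intro v hv
  obtain ⟨a, rfl⟩ := mem_span_singleton.1 hv
  rw [quadraticForm_smul, hx, mul_zero]

lemma isTotallySingular_span_pair {x y : V} (hx : χ x = 0) (hy : χ y = 0)
    (hxy : χ.polarBilin x y = 0) : IsTotallySingular χ (span F {x, y}) := by
  intro v hv
  obtain ⟨a, b, rfl⟩ := mem_span_pair.1 hv
  simp [quadraticForm_add, quadraticForm_smul, hx, hy, hxy]

lemma IsTotallySingular.finrank_le [FiniteDimensional F V] {m : ℕ} (h : HasWittIndex χ m)
    {U : Submodule F V} (hU : IsTotallySingular χ U) : finrank F U ≤ m :=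
  h.2 ⟨U, hU, rfl⟩

lemma IsNonsingular.exists_polarBilin_eq_one (h : IsNonsingular χ) {x : V} (hx : χ x = 0)
    (hx0 : x ≠ 0) : ∃ y, χ.polarBilin x y = 1 := by
  by_contra! hc
  refine hx0 (h x hx fun w => ?_)
  by_contra hw
  apply hc ((χ.polarBilin x w)⁻¹ • w)
  rw [map_smul, smul_eq_mul]
  exact inv_mul_cancel₀ hw

/-- A combination of x and y orthogonal to all of V is a singular vector of the radical, hence zero.
So the functionals B(x, ·) and B(y, ·) are independent, and by reflexivity of V a functional on the
dual space separating them is evaluation at a vector. -/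
lemma IsNonsingular.exists_polarBilin_pair [FiniteDimensional F V] (h : IsNonsingular χ) {x y : V}
    (hx : χ x = 0) (hy : χ y = 0) (hxy : χ.polarBilin x y = 0)
    (hi : LinearIndependent F ![x, y]) :
    ∃ v, χ.polarBilin x v = 1 ∧ χ.polarBilin y v = 0 := by
  have hi' : LinearIndependent F ![χ.polarBilin x, χ.polarBilin y] := by
    rw [LinearIndependent.pair_iff]
    intro s t hst
    refine LinearIndependent.pair_iff.1 hi s t (h _ ?_ fun w => ?_)
    · simp [quadraticForm_add, quadraticForm_smul, hx, hy, hxy]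
    · rw [← QuadraticMap.polarBilin_apply_apply, map_add, map_smul, map_smul, hst]; rfl
  obtain ⟨φ, h1, h2⟩ := exists_dual_one_zero hi'
  refine ⟨(evalEquiv F V).symm φ, ?_, ?_⟩
  · rw [← h1]; exact (apply_evalEquiv_symm_apply (R := F) (M := V) _ _)
  · rw [← h2]; exact (apply_evalEquiv_symm_apply (R := F) (M := V) _ _)

/-- If a totally singular plane U of V (as a vector space) misses x, the functional B(x, ·) still
has a nonzero kernel on U, and any y in it is collinear with x on the quadric. -/
lemma exists_singular_line [FiniteDimensional F V] (h : HasWittIndex χ 2) {x : V} (hx : χ x = 0)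
    (hx0 : x ≠ 0) : ∃ y, LinearIndependent F ![x, y] ∧ IsTotallySingular χ (span F {x, y}) := by
  obtain ⟨U, hU, hU2⟩ := h.1
  by_cases hxU : x ∈ U
  · obtain ⟨y, hi, rfl⟩ := exists_eq_span_pair_of_mem hU2 hxU hx0
    exact ⟨y, hi, hU⟩
  · have hk := LinearMap.finrank_range_add_finrank_ker ((χ.polarBilin x).domRestrict U)
    have hr := finrank_le (LinearMap.range ((χ.polarBilin x).domRestrict U))
    rw [finrank_self] at hr
    have hk0 : LinearMap.ker ((χ.polarBilin x).domRestrict U) ≠ ⊥ := by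
      intro hbot
      rw [hbot, finrank_bot] at hk
      omega
    obtain ⟨y, hy, hy0⟩ := exists_mem_ne_zero_of_ne_bot hk0
    refine ⟨y, ?_, isTotallySingular_span_pair hx (hU _ y.2) hy⟩
    rw [LinearIndependent.pair_symm_iff, LinearIndependent.pair_iff' (by simpa using hy0)]
    rintro a rfl
    exact hxU (smul_mem _ _ y.2)

/-- The normal form of a non-singular quadratic form of Witt index 2 in dimension 5, with respect
to a basis whose first two vectors are a given basis of a totally singular line. -/
lemma exists_normal_basis [CharP F 2] (hV : finrank F V = 5) (h : IsNonsingular χ) {x y : V}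
    (hi : LinearIndependent F ![x, y]) (hU : IsTotallySingular χ (span F {x, y})) :
    ∃ (b : Basis (Fin 5) F V) (a : F), a ≠ 0 ∧ b 0 = x ∧ b 1 = y ∧
      ∀ c : Fin 5 → F, χ (∑ i, c i • b i) = a * (c 0 * c 2 + c 1 * c 3 + c 4 * c 4) := by
  have : FiniteDimensional F V := Module.finite_of_finrank_pos (by omega)
  have hxU : x ∈ span F {x, y} := subset_span (by simp)
  have hyU : y ∈ span F {x, y} := subset_span (by simp)
  have hx := hU _ hxU
  have hy := hU _ hyU
  have hxy := hU.polarBilin_eq_zero hxU hyU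
  have hyx := hU.polarBilin_eq_zero hyU hxU
  have hxx := polarBilin_self χ x
  have hyy := polarBilin_self χ y
  -- Adding χ(f)x to f changes χ(f) by χ(f)B(f, x) = χ(f), which makes the vector singular in
  -- characteristic 2.
  obtain ⟨f, hxf, hyf, hf⟩ : ∃ f, χ.polarBilin x f = 1 ∧ χ.polarBilin y f = 0 ∧ χ f = 0 := by
    obtain ⟨f, h1, h2⟩ := h.exists_polarBilin_pair hx hy hxy hi
    refine ⟨f + χ f • x,
      by simp [-QuadraticMap.polarBilin_apply_apply, h1, hxx],
      by simp [-QuadraticMap.polarBilin_apply_apply, h2, hyx], ?_⟩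
    rw [quadraticForm_add, quadraticForm_smul, hx, map_smul, polarBilin_comm, h1]
    simp [CharTwo.add_self_eq_zero]
  obtain ⟨g, hxg, hyg, hfg, hg⟩ : ∃ g, χ.polarBilin x g = 0 ∧ χ.polarBilin y g = 1 ∧
      χ.polarBilin f g = 0 ∧ χ g = 0 := by
    obtain ⟨g, h1, h2⟩ := h.exists_polarBilin_pair hy hx hyx (LinearIndependent.pair_symm_iff.1 hi)
    have hfx := polarBilin_comm χ f x
    have hfy := polarBilin_comm χ f y
    have hgx := polarBilin_comm χ g x
    have hgy := polarBilin_comm χ g y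
    rw [hxf] at hfx; rw [hyf] at hfy; rw [h2] at hgx; rw [h1] at hgy
    -- The multiple of x makes g orthogonal to f, and the multiple of y makes it singular.
    refine ⟨(g + χ.polarBilin f g • x) + χ g • y,
      by simp [-QuadraticMap.polarBilin_apply_apply, h2, hxx, hxy],
      by simp [-QuadraticMap.polarBilin_apply_apply, h1, hyy, hyx],
      by simp [-QuadraticMap.polarBilin_apply_apply, hfx, hfy, CharTwo.add_self_eq_zero], ?_⟩
    simp [-QuadraticMap.polarBilin_apply_apply, quadraticForm_add, quadraticForm_smul, hx, hy, hxy, hgx, hgy, CharTwo.add_self_eq_zero]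
  have hfx := polarBilin_comm χ f x
  have hfy := polarBilin_comm χ f y
  have hgx := polarBilin_comm χ g x
  have hgy := polarBilin_comm χ g y
  have hgf := polarBilin_comm χ g f
  rw [hxf] at hfx; rw [hyf] at hfy; rw [hxg] at hgx; rw [hyg] at hgy; rw [hfg] at hgf
  have hff := polarBilin_self χ f
  have hgg := polarBilin_self χ g
  -- Four linear conditions on a five-dimensional space. As B is alternating, v turns out to span
  -- the radical, so non-singularity gives χ(v) ≠ 0 below.
  obtain ⟨v, hv0, hxv, hyv, hfv, hgv⟩ : ∃ v, v ≠ 0 ∧ χ.polarBilin x v = 0 ∧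
      χ.polarBilin y v = 0 ∧ χ.polarBilin f v = 0 ∧ χ.polarBilin g v = 0 := by
    let L : V →ₗ[F] (Fin 4 → F) := LinearMap.pi
      ![χ.polarBilin x, χ.polarBilin y, χ.polarBilin f, χ.polarBilin g]
    have hk := LinearMap.finrank_range_add_finrank_ker L
    have hr := finrank_le (LinearMap.range L)
    rw [finrank_fin_fun] at hr
    have hk0 : LinearMap.ker L ≠ ⊥ := by
      intro hbot
      rw [hbot, finrank_bot] at hk
      omega
    obtain ⟨v, hv, hv0⟩ := exists_mem_ne_zero_of_ne_bot hk0
    exact ⟨v, hv0, congrFun hv 0, congrFun hv 1, congrFun hv 2, congrFun hv 3⟩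
  have hvx := polarBilin_comm χ v x
  have hvy := polarBilin_comm χ v y
  have hvf := polarBilin_comm χ v f
  have hvg := polarBilin_comm χ v g
  rw [hxv] at hvx; rw [hyv] at hvy; rw [hfv] at hvf; rw [hgv] at hvg
  have hvv := polarBilin_self χ v
  have hind : ∀ a₀ a₁ a₂ a₃ a₄ : F, a₀ • x + a₁ • y + a₂ • f + a₃ • g + a₄ • v = 0 →
      a₀ = 0 ∧ a₁ = 0 ∧ a₂ = 0 ∧ a₃ = 0 ∧ a₄ = 0 := by
    intro a₀ a₁ a₂ a₃ a₄ h0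
    have e0 := congrArg (χ.polarBilin f) h0
    have e1 := congrArg (χ.polarBilin g) h0
    have e2 := congrArg (χ.polarBilin x) h0
    have e3 := congrArg (χ.polarBilin y) h0
    simp only [map_add, map_smul, map_zero, smul_eq_mul, hxx, hyy, hff, hgg, hxy, hyx, hxf, hfx,
      hxg, hgx, hyf, hfy, hyg, hgy, hfg, hgf, hxv, hyv, hfv, hgv, mul_zero, mul_one, add_zero,
      zero_add] at e0 e1 e2 e3
    subst e0 e1 e2 e3
    refine ⟨rfl, rfl, rfl, rfl, ?_⟩
    simpa [hv0] using h0
  have hbasis : ∀ w : V, ∃ a₀ a₁ a₂ a₃ a₄ : F, w = a₀ • x + a₁ • y + a₂ • f + a₃ • g + a₄ • v := by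
    have hli : LinearIndependent F ![x, y, f, g, v] := by
      rw [Fintype.linearIndependent_iff]
      intro c hc
      have := hind (c 0) (c 1) (c 2) (c 3) (c 4) (by simpa [Fin.sum_univ_five] using hc)
      intro i; fin_cases i
      exacts [this.1, this.2.1, this.2.2.1, this.2.2.2.1, this.2.2.2.2]
    have hcard : Fintype.card (Fin 5) = finrank F V := by simp [hV]
    let b := basisOfLinearIndependentOfCardEqFinrank hli hcard
    intro w
    have := b.sum_repr w
    simp only [b, Fin.sum_univ_five, coe_basisOfLinearIndependentOfCardEqFinrank] at this
    exact ⟨_, _, _, _, _, this.symm⟩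
  have ha : χ v ≠ 0 := by
    intro ha
    refine hv0 (h v ha fun w => ?_)
    obtain ⟨a₀, a₁, a₂, a₃, a₄, rfl⟩ := hbasis w
    rw [← QuadraticMap.polarBilin_apply_apply]
    simp [-QuadraticMap.polarBilin_apply_apply, hvx, hvy, hvf, hvg, hvv]
  -- Scaling f and g by χ(v) makes χ(v) a common factor of all three terms of the form.
  have hli : LinearIndependent F ![x, y, χ v • f, χ v • g, v] := by
    rw [Fintype.linearIndependent_iff]
    intro c hc
    have := hind (c 0) (c 1) (c 2 * χ v) (c 3 * χ v) (c 4)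
      (by simpa [Fin.sum_univ_five, smul_smul] using hc)
    simp only [mul_eq_zero, ha, or_false] at this
    intro i; fin_cases i
    exacts [this.1, this.2.1, this.2.2.1, this.2.2.2.1, this.2.2.2.2]
  have hcard : Fintype.card (Fin 5) = finrank F V := by simp [hV]
  refine ⟨basisOfLinearIndependentOfCardEqFinrank hli hcard, χ v, ha, by simp, by simp,
    fun c => ?_⟩
  simp only [Fin.sum_univ_five, coe_basisOfLinearIndependentOfCardEqFinrank]
  simp [-QuadraticMap.polarBilin_apply_apply, quadraticForm_add, quadraticForm_smul, hx, hy, hf, hg, hxy, hxf, hxg, hyf, hyg, hfg,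
    hxv, hyv, hfv, hgv]
  ring

end QuadraticForms

/-! ### The symplectic form on the spin module -/

section Symplectic

universe u

variable {F : Type u} [Field F]

/-- The alternating form of `symplecticQuadrangle`, as a bilinear form. -/
def symplecticBilin : LinearMap.BilinForm F (Fin 4 → F) :=
  LinearMap.mk₂ F symplecticForm (fun x y z => by simp [symplecticForm]; ring)
    (fun c x y => by simp [symplecticForm]; ring) (fun x y z => by simp [symplecticForm]; ring)
    (fun c x y => by simp [symplecticForm]; ring)

lemma symplecticBilin_apply (x y : Fin 4 → F) : symplecticBilin x y = symplecticForm x y := rfl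

lemma symplecticBilin_swap (x y : Fin 4 → F) : symplecticBilin y x = - symplecticBilin x y := by
  simp only [symplecticBilin_apply, symplecticForm]; ring

lemma symplecticBilin_nondegenerate : (symplecticBilin (F := F)).Nondegenerate := by
  suffices hs : LinearMap.SeparatingLeft (symplecticBilin (F := F)) from
    ⟨hs, fun y hy => hs y fun x => by rw [symplecticBilin_swap, hy x, neg_zero]⟩
  intro x hx
  have h : ∀ i, symplecticForm x (Pi.single i 1) = 0 := fun i => hx _
  have h0 := h 0
  have h1 := h 1
  have h2 := h 2
  have h3 := h 3
  simp [symplecticForm] at h0 h1 h2 h3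
  ext i; fin_cases i <;> simp [*]

lemma finrank_symplectic_orthogonal (L : Submodule F (Fin 4 → F)) :
    finrank F (symplecticBilin.orthogonal L) = 4 - finrank F L := by
  rw [LinearMap.BilinForm.finrank_orthogonal symplecticBilin_nondegenerate,
    finrank_fin_fun]

end Symplectic

/-! ### The spin module and the duality between the quadric and W(3, F) -/

section Spin

universe u

variable {F V : Type u} [Field F] [AddCommGroup V] [Module F V]

/-- `T` is a spin representation of `χ` on `F⁴`: up to a scalar, a representation of the Clifford
algebra of `χ` for which every `⟨T v w, w⟩` vanishes. -/
structure IsSpin (χ : QuadraticForm F V) (T : V →ₗ[F] (Fin 4 → F) →ₗ[F] (Fin 4 → F)) : Prop where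
  sq : ∃ k : F, k ≠ 0 ∧ ∀ v w, T v (T v w) = (k * χ v) • w
  alt : ∀ v w, symplecticBilin (T v w) w = 0

/-- The action of `F⁵` on `F⁴` by the Clifford algebra of `c₀c₂ + c₁c₃ + c₄²`. -/
def spinAction : (Fin 5 → F) →ₗ[F] (Fin 4 → F) →ₗ[F] (Fin 4 → F) :=
  LinearMap.mk₂ F (fun c w => ![c 4 * w 0 + c 1 * w 1 + c 0 * w 3, c 3 * w 0 + c 4 * w 1 + c 0 * w 2,
    c 2 * w 1 + c 4 * w 2 + c 3 * w 3, c 2 * w 0 + c 1 * w 2 + c 4 * w 3])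
    (fun x y z => by ext i; fin_cases i <;> simp <;> ring)
    (fun c x y => by ext i; fin_cases i <;> simp <;> ring)
    (fun x y z => by ext i; fin_cases i <;> simp <;> ring)
    (fun c x y => by ext i; fin_cases i <;> simp <;> ring)

lemma spinAction_apply (c : Fin 5 → F) (w : Fin 4 → F) : spinAction c w =
    ![c 4 * w 0 + c 1 * w 1 + c 0 * w 3, c 3 * w 0 + c 4 * w 1 + c 0 * w 2,
      c 2 * w 1 + c 4 * w 2 + c 3 * w 3, c 2 * w 0 + c 1 * w 2 + c 4 * w 3] := rfl

/-- The matrices square to c₀c₂ + c₁c₃ + c₄², which is χ without its factor a; this is why `IsSpin`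
allows a scalar, here a⁻¹. -/
lemma exists_isSpin [CharP F 2] {χ : QuadraticForm F V} {b : Basis (Fin 5) F V} {a : F}
    (ha : a ≠ 0)
    (hb : ∀ c : Fin 5 → F, χ (∑ i, c i • b i) = a * (c 0 * c 2 + c 1 * c 3 + c 4 * c 4)) :
    ∃ T, IsSpin χ T := by
  have h2 : (2 : F) = 0 := CharTwo.two_eq_zero
  refine ⟨spinAction ∘ₗ b.equivFun.toLinearMap, ⟨a⁻¹, inv_ne_zero ha, fun v w => ?_⟩, fun v w => ?_⟩
  · have hv := hb (b.equivFun v)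
    rw [b.sum_equivFun] at hv
    rw [hv, inv_mul_cancel_left₀ ha]
    generalize hc : b.equivFun v = c
    simp only [LinearMap.comp_apply, LinearEquiv.coe_coe, hc, spinAction_apply]
    ext i
    fin_cases i <;> simp
    -- Each mixed term of the squared matrix occurs twice and so vanishes; the same holds in the
    -- other rows.
    · linear_combination (c 4 * c 1 * w 1 + c 4 * c 0 * w 3 + c 0 * c 1 * w 2) * h2
    · linear_combination (c 4 * c 3 * w 0 + c 4 * c 0 * w 2 + c 0 * c 3 * w 3) * h2
    · linear_combination (c 4 * c 2 * w 1 + c 4 * c 3 * w 3 + c 2 * c 3 * w 0) * h2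
    · linear_combination (c 4 * c 2 * w 0 + c 4 * c 1 * w 2 + c 1 * c 2 * w 1) * h2
  · generalize hc : b.equivFun v = c
    simp only [LinearMap.comp_apply, LinearEquiv.coe_coe, hc, spinAction_apply,
      symplecticBilin_apply, symplecticForm]
    simp
    linear_combination (c 0 * w 2 * w 3 - c 2 * w 0 * w 1) * h2

namespace IsSpin

variable {χ : QuadraticForm F V} {T : V →ₗ[F] (Fin 4 → F) →ₗ[F] (Fin 4 → F)}

lemma apply_apply_of_singular (h : IsSpin χ T) {x : V} (hx : χ x = 0) (w) : T x (T x w) = 0 := by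
  obtain ⟨k, -, hk⟩ := h.sq
  rw [hk, hx, mul_zero, zero_smul]

lemma singular_of_apply_eq_zero (h : IsSpin χ T) {x : V} {w} (hw : w ≠ 0) (hx : T x w = 0) :
    χ x = 0 := by
  obtain ⟨k, hk0, hk⟩ := h.sq
  have := hk x w
  rw [hx, map_zero] at this
  have := smul_eq_zero.1 this.symm
  simpa [hk0, hw] using this

lemma anticomm (h : IsSpin χ T) : ∃ k : F, k ≠ 0 ∧
    ∀ x y w, T x (T y w) + T y (T x w) = (k * χ.polarBilin x y) • w := by
  obtain ⟨k, hk0, hk⟩ := h.sq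
  refine ⟨k, hk0, fun x y w => ?_⟩
  have := hk (x + y) w
  simp only [quadraticForm_add, map_add, LinearMap.add_apply, hk] at this
  have h2 : T x (T y w) + T y (T x w) = (k * (χ x + χ y + χ.polarBilin x y)) • w -
      (k * χ x) • w - (k * χ y) • w := by rw [← this]; abel
  rw [h2]; module

/-- Polarizing ⟨T x w, w⟩ = 0 in w shows that `T x` is self-adjoint. -/
lemma symm (h : IsSpin χ T) (x : V) (w w') :
    symplecticBilin (T x w) w' = symplecticBilin w (T x w') := by
  have := h.alt x (w + w')
  simp only [map_add, LinearMap.add_apply, h.alt] at this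
  rw [symplecticBilin_swap (T x w') w]
  linear_combination this

/-- Since `T x` squares to zero, its range lies in its kernel. If B(x, y) = 1, then T x T y + T y T
x is a nonzero scalar k, so w = T x (k⁻¹ T y w) for w in the kernel. Equality of kernel and range
splits dimension 4 in half. -/
lemma finrank_ker (h : IsSpin χ T) (hns : IsNonsingular χ) {x : V} (hx : χ x = 0) (hx0 : x ≠ 0) :
    finrank F (LinearMap.ker (T x)) = 2 ∧ LinearMap.ker (T x) = LinearMap.range (T x) := by
  obtain ⟨y, hy⟩ := hns.exists_polarBilin_eq_one hx hx0
  obtain ⟨k, hk0, hk⟩ := h.anticomm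
  have he : LinearMap.ker (T x) = LinearMap.range (T x) := by
    apply le_antisymm
    · intro w hw
      have := hk x y w
      rw [LinearMap.mem_ker.1 hw, map_zero, add_zero, hy, mul_one] at this
      refine ⟨k⁻¹ • T y w, ?_⟩
      rw [map_smul, this, smul_smul, inv_mul_cancel₀ hk0, one_smul]
    · rintro _ ⟨w, rfl⟩
      exact h.apply_apply_of_singular hx w
  refine ⟨?_, he⟩
  have := LinearMap.finrank_range_add_finrank_ker (T x)
  rw [← he, finrank_fin_fun] at this
  omega

lemma isotropic_ker (h : IsSpin χ T) (hns : IsNonsingular χ) {x : V} (hx : χ x = 0) (hx0 : x ≠ 0) :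
    ∀ w ∈ LinearMap.ker (T x), ∀ w' ∈ LinearMap.ker (T x), symplecticForm w w' = 0 := by
  intro w hw w' hw'
  rw [(h.finrank_ker hns hx hx0).2] at hw
  obtain ⟨u, rfl⟩ := hw
  rw [← symplecticBilin_apply, h.symm, LinearMap.mem_ker.1 hw', map_zero]

/-- The map x ↦ T x w takes values in the three-dimensional space w^⊥, so its kernel has dimension
at least 2; the kernel is totally singular, so the Witt index bounds it by 2. -/
lemma finrank_ker_flip (h : IsSpin χ T) (hV : finrank F V = 5) (hwitt : HasWittIndex χ 2)
    {w : Fin 4 → F} (hw : w ≠ 0) :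
    finrank F (LinearMap.ker (T.flip w)) = 2 ∧ IsTotallySingular χ (LinearMap.ker (T.flip w)) := by
  have : FiniteDimensional F V := Module.finite_of_finrank_pos (by omega)
  have hs : IsTotallySingular χ (LinearMap.ker (T.flip w)) :=
    fun x hx => h.singular_of_apply_eq_zero hw hx
  refine ⟨le_antisymm (hs.finrank_le hwitt) ?_, hs⟩
  have hr : LinearMap.range (T.flip w) ≤ symplecticBilin.orthogonal (span F {w}) := by
    rintro _ ⟨x, rfl⟩
    rw [LinearMap.BilinForm.mem_orthogonal_iff]
    intro z hz
    obtain ⟨c, rfl⟩ := mem_span_singleton.1 hz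
    rw [symplecticBilin_swap, LinearMap.flip_apply, map_smul, h.alt,
      smul_zero, neg_zero]
  have := finrank_mono hr
  rw [finrank_symplectic_orthogonal, finrank_span_singleton hw] at this
  have := LinearMap.finrank_range_add_finrank_ker (T.flip w)
  omega

/-- For orthogonal x and y the operators anticommute, so if w lies in ker `T x` then so does T y w,
and `T y` kills T y w. -/
lemma exists_common_kernel (h : IsSpin χ T) (hns : IsNonsingular χ) {x y : V} (hx : χ x = 0)
    (hx0 : x ≠ 0) (hy : χ y = 0) (hxy : χ.polarBilin x y = 0) :
    ∃ w, w ≠ 0 ∧ T x w = 0 ∧ T y w = 0 := by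
  have hne : LinearMap.ker (T x) ≠ ⊥ := by
    intro hb
    have := (h.finrank_ker hns hx hx0).1
    rw [hb, finrank_bot] at this
    omega
  obtain ⟨w, hw, hw0⟩ := exists_mem_ne_zero_of_ne_bot hne
  by_cases hyw : T y w = 0
  · exact ⟨w, hw0, hw, hyw⟩
  · refine ⟨T y w, hyw, ?_, h.apply_apply_of_singular hy w⟩
    obtain ⟨k, -, hk⟩ := h.anticomm
    have := hk x y w
    rwa [LinearMap.mem_ker.1 hw, map_zero, add_zero, hxy, mul_zero, zero_smul] at this

/-- Two independent common zeros fill the two-dimensional kernel of `T x`, which gives T y T x = 0.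
The Clifford relations then produce a nonzero combination of x and y acting as zero; it is singular,
so its kernel should have dimension 2 and not 4. -/
lemma not_linearIndependent_kernel (h : IsSpin χ T) (hns : IsNonsingular χ) {x y : V}
    (hx : χ x = 0) (hi : LinearIndependent F ![x, y]) {w w' : Fin 4 → F}
    (hw : T x w = 0) (hw' : T x w' = 0) (hyw : T y w = 0) (hyw' : T y w' = 0) :
    ¬ LinearIndependent F ![w, w'] := by
  intro hi'
  have hx0 : x ≠ 0 := hi.ne_zero 0
  obtain ⟨h2, he⟩ := h.finrank_ker hns hx hx0
  have hK : LinearMap.ker (T x) ≤ LinearMap.ker (T y) := by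
    rw [span_pair_eq_of_le hi' h2 hw hw', span_le]
    rintro _ (rfl | rfl) <;> assumption
  have hyx : ∀ u, T y (T x u) = 0 := fun u => hK (h.apply_apply_of_singular hx u)
  obtain ⟨z, hz⟩ := hns.exists_polarBilin_eq_one hx hx0
  obtain ⟨k, hk0, hk⟩ := h.anticomm
  -- T y T z T x u is computed in two ways: by anticommuting y and z it is kB(y, z) T x u, and by
  -- anticommuting x and z it is kB(x, z) T y u.
  have key : ∀ u, T (χ.polarBilin y z • x + (-χ.polarBilin x z) • y) u = 0 := by
    intro u
    have e1 := hk y z (T x u)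
    have e2 := hk x z u
    rw [hyx, map_zero, add_zero] at e1
    have e3 := congrArg (T y) e2
    rw [map_add, hyx, zero_add, e1, map_smul, mul_smul, mul_smul] at e3
    have e4 := smul_right_injective _ hk0 e3
    simp only [map_add, map_smul, LinearMap.add_apply, LinearMap.smul_apply]
    rw [e4]; module
  set v := χ.polarBilin y z • x + (-χ.polarBilin x z) • y with hv
  have hv0 : v ≠ 0 := by
    intro h0
    have := (LinearIndependent.pair_iff.1 hi _ _ h0).2
    rw [hz] at this
    simp at this
  have hvs : χ v = 0 := h.singular_of_apply_eq_zero (hi'.ne_zero 0) (key _)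
  have h4 := (h.finrank_ker hns hvs hv0).1
  have : LinearMap.ker (T v) = ⊤ := by
    rw [eq_top_iff]; exact fun u _ => key u
  rw [this, finrank_top, finrank_fin_fun] at h4
  omega

lemma exists_ker_eq (h : IsSpin χ T) (hV : finrank F V = 5) (hns : IsNonsingular χ)
    (hwitt : HasWittIndex χ 2) {L : Submodule F (Fin 4 → F)} (hL : finrank F L = 2)
    (hiso : ∀ w ∈ L, ∀ w' ∈ L, symplecticForm w w' = 0) :
    ∃ x, χ x = 0 ∧ x ≠ 0 ∧ LinearMap.ker (T x) = L := by
  obtain ⟨w, w', hi, rfl⟩ := exists_eq_span_pair hL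
  have hwL : w ∈ span F {w, w'} := subset_span (by simp)
  have hwL' : w' ∈ span F {w, w'} := subset_span (by simp)
  have hw0 : w ≠ 0 := hi.ne_zero 0
  obtain ⟨hU, hUs⟩ := h.finrank_ker_flip hV hwitt hw0
  -- A totally isotropic line of a four-dimensional symplectic space is its own orthogonal.
  have hLo : symplecticBilin.orthogonal (span F {w, w'}) = span F {w, w'} := by
    symm
    apply eq_of_le_of_finrank_eq
    · intro z hz
      rw [LinearMap.BilinForm.mem_orthogonal_iff]
      exact fun u hu => hiso u hu z hz
    · rw [finrank_symplectic_orthogonal, hL]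
  have hmaps : ∀ x ∈ LinearMap.ker (T.flip w), T x w' ∈ span F {w, w'} := by
    intro x hx
    have hx : T x w = 0 := hx
    rw [← hLo, LinearMap.BilinForm.mem_orthogonal_iff]
    intro u hu
    obtain ⟨a, b, rfl⟩ := mem_span_pair.1 hu
    rw [← h.symm, map_add, map_smul, map_smul, hx, smul_zero,
      zero_add, map_smul, LinearMap.smul_apply, h.alt, smul_zero]
  let f : LinearMap.ker (T.flip w) →ₗ[F] span F {w, w'} :=
    ((T.flip w').domRestrict _).codRestrict _ fun x => hmaps x x.2
  -- The map x ↦ T x w' goes between two-dimensional spaces; if injective it would hit w' itself,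
  -- although `T x` is nilpotent for singular x. A nonzero x in its kernel kills both w and w'.
  have hf : ¬ Function.Injective f := by
    intro hinj
    have : FiniteDimensional F (LinearMap.ker (T.flip w)) :=
      Module.finite_of_finrank_pos (by omega)
    have hsurj := (LinearMap.injective_iff_surjective_of_finrank_eq_finrank
      (by rw [hU, hL])).1 hinj
    obtain ⟨x, hx⟩ := hsurj ⟨w', hwL'⟩
    have hx' : T x w' = w' := congrArg Subtype.val hx
    have := h.apply_apply_of_singular (hUs x x.2) w'
    rw [hx', hx'] at this
    exact hi.ne_zero 1 this
  rw [← LinearMap.ker_eq_bot] at hf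
  obtain ⟨x, hx, hx0⟩ := exists_mem_ne_zero_of_ne_bot hf
  have hxw : T x w = 0 := x.2
  have hxw' : T x w' = 0 := congrArg Subtype.val (LinearMap.mem_ker.1 hx)
  have hx0' : (x : V) ≠ 0 := by simpa using hx0
  exact ⟨x, hUs x x.2, hx0', span_pair_eq_of_le hi
    (h.finrank_ker hns (hUs x x.2) hx0').1 hxw hxw'⟩

/-- The vectors of `V` that annihilate a subspace of the spin module. -/
def annihilator (T : V →ₗ[F] (Fin 4 → F) →ₗ[F] (Fin 4 → F)) (p : Submodule F (Fin 4 → F)) :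
    Submodule F V :=
  ⨅ w ∈ p, LinearMap.ker (T.flip w)

lemma le_annihilator_iff {x : V} {p : Submodule F (Fin 4 → F)} :
    span F {x} ≤ annihilator T p ↔ p ≤ LinearMap.ker (T x) := by
  rw [span_singleton_le_iff_mem]
  simp [annihilator, SetLike.le_def]

lemma annihilator_span_singleton (w : Fin 4 → F) :
    annihilator T (span F {w}) = LinearMap.ker (T.flip w) := by
  ext x
  rw [← span_singleton_le_iff_mem, le_annihilator_iff, span_singleton_le_iff_mem]
  rfl

lemma finrank_annihilator (h : IsSpin χ T) (hV : finrank F V = 5) (hwitt : HasWittIndex χ 2)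
    {p : Submodule F (Fin 4 → F)} (hp : finrank F p = 1) :
    finrank F (annihilator T p) = 2 ∧ IsTotallySingular χ (annihilator T p) := by
  obtain ⟨w, hw, rfl⟩ := exists_eq_span_singleton hp
  rw [annihilator_span_singleton]
  exact h.finrank_ker_flip hV hwitt hw

/-- A totally singular line has at most one common zero up to scalars, by
`not_linearIndependent_kernel`. -/
lemma annihilator_injective (h : IsSpin χ T) (hV : finrank F V = 5) (hns : IsNonsingular χ)
    (hwitt : HasWittIndex χ 2) {p p' : Submodule F (Fin 4 → F)} (hp : finrank F p = 1)
    (hp' : finrank F p' = 1) (he : annihilator T p = annihilator T p') : p = p' := by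
  obtain ⟨h2, hs⟩ := h.finrank_annihilator hV hwitt hp
  obtain ⟨w, hw, rfl⟩ := exists_eq_span_singleton hp
  obtain ⟨w', hw', rfl⟩ := exists_eq_span_singleton hp'
  obtain ⟨x, y, hi, hxy⟩ := exists_eq_span_pair h2
  have hx : x ∈ annihilator T (span F {w}) := by rw [hxy]; exact subset_span (by simp)
  have hy : y ∈ annihilator T (span F {w}) := by rw [hxy]; exact subset_span (by simp)
  have hx' := hx
  have hy' := hy
  rw [he, annihilator_span_singleton] at hx' hy'
  have hx1 := hx
  have hy1 := hy
  rw [annihilator_span_singleton] at hx1 hy1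
  have hdep := h.not_linearIndependent_kernel hns (hs x hx) hi hx1 hx' hy1 hy'
  rw [LinearIndependent.pair_iff' hw] at hdep
  push Not at hdep
  obtain ⟨a, rfl⟩ := hdep
  have ha : a ≠ 0 := by rintro rfl; simp at hw'
  exact (span_singleton_smul_eq (IsUnit.mk0 _ ha) w).symm

lemma exists_annihilator_eq (h : IsSpin χ T) (hV : finrank F V = 5) (hns : IsNonsingular χ)
    (hwitt : HasWittIndex χ 2) {U : Submodule F V} (hU : finrank F U = 2)
    (hs : IsTotallySingular χ U) :
    ∃ p : Submodule F (Fin 4 → F), finrank F p = 1 ∧ annihilator T p = U := by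
  obtain ⟨x, y, hi, rfl⟩ := exists_eq_span_pair hU
  have hx : x ∈ span F {x, y} := subset_span (by simp)
  have hy : y ∈ span F {x, y} := subset_span (by simp)
  obtain ⟨w, hw, h1, h2⟩ := h.exists_common_kernel hns (hs x hx) (hi.ne_zero 0) (hs y hy)
    (hs.polarBilin_eq_zero hx hy)
  refine ⟨span F {w}, finrank_span_singleton hw, ?_⟩
  rw [annihilator_span_singleton]
  exact span_pair_eq_of_le hi (h.finrank_ker_flip hV hwitt hw).1 h1 h2

theorem dual_isomorphic (h : IsSpin χ T) (hV : finrank F V = 5) (hns : IsNonsingular χ)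
    (hwitt : HasWittIndex χ 2) :
    (quadricGeometry χ).dual.Isomorphic (symplecticQuadrangle F) := by
  let g : (symplecticQuadrangle F).Pt → (quadricGeometry χ).dual.Pt := fun p =>
    ⟨{q | q.1 ≤ annihilator T p.1}, _, (h.finrank_annihilator hV hwitt p.2).1,
      (h.finrank_annihilator hV hwitt p.2).2, rfl⟩
  have hle : ∀ p p' : (symplecticQuadrangle F).Pt, g p = g p' →
      annihilator T p.1 ≤ annihilator T p'.1 := by
    intro p p' hg x hx
    by_cases hx0 : x = 0
    · rw [hx0]; exact zero_mem _
    have hxs := (h.finrank_annihilator hV hwitt p.2).2 x hx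
    let q : (quadricGeometry χ).Pt :=
      ⟨span F {x}, finrank_span_singleton hx0, isTotallySingular_span_singleton hxs⟩
    have h1 : q ∈ (g p).1 := (span_singleton_le_iff_mem _ _).2 hx
    rw [hg] at h1
    exact (span_singleton_le_iff_mem _ _).1 h1
  have hg : Function.Bijective g := by
    constructor
    · intro p p' hpp
      exact Subtype.ext (h.annihilator_injective hV hns hwitt p.2 p'.2
        (le_antisymm (hle p p' hpp) (hle p' p hpp.symm)))
    · rintro ⟨_, U, hU, hs, rfl⟩
      obtain ⟨p, hp, rfl⟩ := h.exists_annihilator_eq hV hns hwitt hU hs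
      exact ⟨⟨p, hp⟩, rfl⟩
  -- The lines of the quadric through ⟨x⟩ correspond to the points of ker `T x`: both conditions say
  -- that `T x` kills p.
  have hpencil : ∀ x (hx : χ x = 0) (hx0 : x ≠ 0),
      g ⁻¹' {l | (⟨span F {x}, finrank_span_singleton hx0, isTotallySingular_span_singleton hx⟩ :
        (quadricGeometry χ).Pt) ∈ l.1} = {p | p.1 ≤ LinearMap.ker (T x)} := by
    intro x hx hx0
    ext p
    exact le_annihilator_iff
  refine ⟨(Equiv.ofBijective g hg).symm, fun s => ?_⟩
  rw [Equiv.image_symm_eq_preimage]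
  change _ ↔ g ⁻¹' s ∈ _
  constructor
  · rintro ⟨⟨q, hq1, hqs⟩, rfl⟩
    obtain ⟨x, hx0, rfl⟩ := exists_eq_span_singleton hq1
    have hx := hqs x (mem_span_singleton_self x)
    exact ⟨_, (h.finrank_ker hns hx hx0).1, h.isotropic_ker hns hx hx0, hpencil x hx hx0⟩
  · rintro ⟨L, hL, hiso, he⟩
    obtain ⟨x, hx, hx0, rfl⟩ := h.exists_ker_eq hV hns hwitt hL hiso
    exact ⟨_, Set.preimage_injective.2 hg.2 (he.trans (hpencil x hx hx0).symm)⟩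

end IsSpin

end Spin

/-! ### The position of N relative to conics and their planes -/

section NucleusSpan

variable {F : Type*} [Field F] {n : ℕ}

lemma lineNucleus_le_nucleusSpan {U : Submodule F (Fin n → F)} (hU : finrank F U = 2) :
    lineNucleus U ≤ nucleusSpan F n :=
  le_iSup₂_of_le (f := fun (U : Submodule F (Fin n → F)) (_ : finrank F U = 2) => lineNucleus U)
    U hU le_rfl

variable [CharP F 2]

/-- The polarization 2φ(x)φ(y) of φ² vanishes in characteristic 2, so every such functional factors
through V^⊗/N. -/
lemma productForm_self_eq_zero {Q : VeroneseSpace F n →ₗ[F] F} {φ : (Fin n → F) →ₗ[F] F}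
    (hQ : ∀ x, Q (veroneseVec x) = φ x * φ x) {z : VeroneseSpace F n}
    (hz : z ∈ nucleusSpan F n) : Q z = 0 := by
  refine nucleusSpan_le (S := LinearMap.ker Q) (fun x y => ?_) hz
  rw [LinearMap.mem_ker, map_veronesePolar hQ, mul_comm (φ y), CharTwo.add_self_eq_zero]

lemma lineNucleus_le_sSup {U : Submodule F (Fin n → F)} (hU : finrank F U = 2) :
    lineNucleus U ≤ sSup (veroneseImage U) := by
  obtain ⟨x, y, h, rfl⟩ := exists_eq_span_pair hU
  rw [lineNucleus_span_pair h, sSup_veroneseImage]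
  exact span_mono (by simp)

lemma nucleusSpan_inf_sSup {U : Submodule F (Fin n → F)} (hU : finrank F U = 2) :
    nucleusSpan F n ⊓ sSup (veroneseImage U) = lineNucleus U := by
  apply le_antisymm _ (le_inf (lineNucleus_le_nucleusSpan hU) (lineNucleus_le_sSup hU))
  obtain ⟨x, y, h, rfl⟩ := exists_eq_span_pair hU
  rintro z ⟨hzN, hzS⟩
  rw [SetLike.mem_coe, sSup_veroneseImage] at hzS
  obtain ⟨a, b, c, rfl⟩ := mem_span_triple.1 hzS
  obtain ⟨φ, ψ, h1, h2, h3, h4⟩ := exists_dual_pair h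
  have key : ∀ φ : (Fin n → F) →ₗ[F] F, a * (φ x * φ x) + b * (φ y * φ y) = 0 := by
    intro φ
    obtain ⟨Q, hQ⟩ := exists_productForm φ φ
    have := productForm_self_eq_zero hQ hzN
    simpa [hQ, map_veronesePolar hQ, mul_comm (φ y), CharTwo.add_self_eq_zero] using this
  have ha := key φ
  have hb := key ψ
  simp only [h1, h2, h3, h4, mul_one, mul_zero, add_zero, zero_add] at ha hb
  rw [ha, hb, zero_smul, zero_smul, zero_add, zero_add, lineNucleus_span_pair h]
  exact smul_mem _ _ (mem_span_singleton_self _)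

/-- If φ vanishes on U but not at x, the hyperplane of φ² contains η(U) and N but not η(x). This
serves for injectivity, for fullness of lines and for the quotient condition on points off a line.
-/
lemma mem_of_veroneseVec_mem {U : Submodule F (Fin n → F)} {x : Fin n → F}
    (hx : veroneseVec x ∈ sSup (veroneseImage U) ⊔ nucleusSpan F n) : x ∈ U := by
  by_contra hxU
  obtain ⟨φ, hφ, hle⟩ := exists_le_ker_of_notMem hxU
  obtain ⟨Q, hQ⟩ := exists_productForm φ φ
  have h : sSup (veroneseImage U) ⊔ nucleusSpan F n ≤ LinearMap.ker Q := by
    refine sup_le (sSup_le ?_) fun z hz => productForm_self_eq_zero hQ hz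
    rw [veroneseImage_eq]
    rintro _ ⟨u, hu, -, rfl⟩
    have hu' : φ u = 0 := hle hu
    rw [span_singleton_le_iff_mem, LinearMap.mem_ker, hQ, hu', mul_zero]
  have := h hx
  rw [LinearMap.mem_ker, hQ] at this
  exact hφ (mul_self_eq_zero.1 this)

lemma span_veroneseVec_pair_inf (x y : Fin n → F) :
    (span F {veroneseVec x} ⊔ span F {veroneseVec y}) ⊓ nucleusSpan F n = ⊥ := by
  rw [eq_bot_iff]
  rintro z ⟨hz, hzN⟩
  rw [SetLike.mem_coe, ← span_union, Set.singleton_union] at hz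
  obtain ⟨a, b, rfl⟩ := mem_span_pair.1 hz
  have key : ∀ φ : (Fin n → F) →ₗ[F] F, a * (φ x * φ x) + b * (φ y * φ y) = 0 := by
    intro φ
    obtain ⟨Q, hQ⟩ := exists_productForm φ φ
    simpa [hQ] using productForm_self_eq_zero hQ hzN
  by_cases h : LinearIndependent F ![x, y]
  · obtain ⟨φ, ψ, h1, h2, h3, h4⟩ := exists_dual_pair h
    have ha := key φ
    have hb := key ψ
    simp only [h1, h2, h3, h4, mul_one, mul_zero, add_zero, zero_add] at ha hb
    rw [ha, hb, zero_smul, zero_smul, add_zero]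
    exact zero_mem _
  · have hm := veronesePolar_eq_zero_iff.2 h
    rw [mem_bot]
    ext p
    have hp := congrFun hm p
    have h1 := key (LinearMap.proj p.1.1)
    have h2 := key (LinearMap.proj p.1.2)
    simp only [LinearMap.proj_apply] at h1 h2
    rw [veronesePolar_apply] at hp
    simp only [Pi.add_apply, Pi.smul_apply, smul_eq_mul, veroneseVec, Pi.zero_apply] at hp ⊢
    -- For dependent x and y (possibly zero or equal), the square of each coordinate ax_i x_j + by_i
    -- y_j is the product of ax_i² + by_i² and ax_j² + by_j², up to a multiple of the minor x_i y_j
    -- + y_i x_j and a multiple of 2; all of these vanish.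
    have : (a * (x p.1.1 * x p.1.2) + b * (y p.1.1 * y p.1.2)) *
        (a * (x p.1.1 * x p.1.2) + b * (y p.1.1 * y p.1.2)) = 0 := by
      have h0 : (2 : F) = 0 := CharTwo.two_eq_zero
      linear_combination (a * (x p.1.2 * x p.1.2) + b * (y p.1.2 * y p.1.2)) * h1 -
        a * b * (x p.1.1 * y p.1.2 + y p.1.1 * x p.1.2) * hp +
        2 * a * b * x p.1.1 * x p.1.2 * y p.1.1 * y p.1.2 * h0
    exact mul_self_eq_zero.1 this

lemma le_of_lineNucleus_eq {U U' : Submodule F (Fin n → F)} (hU : finrank F U = 2)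
    (hU' : finrank F U' = 2) (h : lineNucleus U = lineNucleus U') : U' ≤ U := by
  obtain ⟨x, y, hi, rfl⟩ := exists_eq_span_pair hU
  intro u hu
  by_cases hu0 : u = 0
  · rw [hu0]; exact zero_mem _
  obtain ⟨v, hi', rfl⟩ := exists_eq_span_pair_of_mem hU' hu hu0
  rw [lineNucleus_span_pair hi, lineNucleus_span_pair hi'] at h
  have hm : veronesePolar x y ∈ span F {veronesePolar u v} := by
    rw [← h]; exact mem_span_singleton_self _
  obtain ⟨c, hc⟩ := mem_span_singleton.1 hm
  rw [← map_smul] at hc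
  refine mem_span_pair_of_veronesePolar_eq hc.symm ?_
  rw [hc, Ne, veronesePolar_eq_zero_iff, not_not]
  exact hi

end NucleusSpan

/-! ### The veronesean and nucleus embeddings of a quadric -/

section Quadric

universe u

variable {F : Type u} [Field F] {n : ℕ} {χ : QuadraticForm F (Fin n → F)}

/-- The points of the quadric geometry that lie in a subspace. -/
def pointsIn (χ : QuadraticForm F (Fin n → F)) (U : Submodule F (Fin n → F)) :
    Set (quadricGeometry χ).Pt :=
  {p | p.1 ≤ U}

lemma mem_pointsIn {U : Submodule F (Fin n → F)} {p : (quadricGeometry χ).Pt} :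
    p ∈ pointsIn χ U ↔ p.1 ≤ U := Iff.rfl

lemma mem_lines_iff {l : Set (quadricGeometry χ).Pt} : l ∈ (quadricGeometry χ).lines ↔
    ∃ U : Submodule F (Fin n → F), finrank F U = 2 ∧ IsTotallySingular χ U ∧ l = pointsIn χ U :=
  Iff.rfl

lemma quadricGeometry_point {χ : QuadraticForm F (Fin n → F)} (p : (quadricGeometry χ).Pt) :
    ∃ x, x ≠ 0 ∧ χ x = 0 ∧ p.1 = span F {x} := by
  obtain ⟨x, hx0, hx⟩ := exists_eq_span_singleton p.2.1
  exact ⟨x, hx0, p.2.2 x (by rw [hx]; exact mem_span_singleton_self x), hx⟩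

lemma naturalVeronesean_image {U : Submodule F (Fin n → F)} (hs : IsTotallySingular χ U) :
    naturalVeronesean χ '' pointsIn χ U = veroneseImage U := by
  ext c; constructor
  · rintro ⟨p, hp, rfl⟩
    exact ⟨p.1, p.2.1, hp, rfl⟩
  · rintro ⟨p, hp, hpU, rfl⟩
    exact ⟨⟨p, hp, fun v hv => hs v (hpU hv)⟩, hpU, rfl⟩

lemma lineSpan_naturalVeronesean {U : Submodule F (Fin n → F)} (hs : IsTotallySingular χ U) :
    lineSpan (naturalVeronesean χ) (pointsIn χ U) = sSup (veroneseImage U) := by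
  rw [← naturalVeronesean_image hs, sSup_image, lineSpan]

lemma lineSpan_naturalEmbedding {U : Submodule F (Fin n → F)} (hs : IsTotallySingular χ U) :
    lineSpan (naturalEmbedding χ) (pointsIn χ U) = U := by
  apply le_antisymm
  · exact iSup₂_le fun p hp => hp
  · intro x hx
    by_cases hx0 : x = 0
    · rw [hx0]; exact zero_mem _
    · let p : (quadricGeometry χ).Pt := ⟨span F {x}, finrank_span_singleton hx0,
        isTotallySingular_span_singleton (hs x hx)⟩
      have hp : p ∈ pointsIn χ U := (span_singleton_le_iff_mem _ _).2 hx
      have hle : naturalEmbedding χ p ≤ lineSpan (naturalEmbedding χ) (pointsIn χ U) :=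
        le_iSup₂_of_le p hp le_rfl
      exact hle (mem_span_singleton_self x)

lemma nucleusEmbedding_eq {U : Submodule F (Fin n → F)} (hs : IsTotallySingular χ U) (h) :
    nucleusEmbedding (quadricGeometry χ) (naturalEmbedding χ) ⟨pointsIn χ U, h⟩ =
      lineNucleus U := by
  rw [lineNucleus, ← naturalVeronesean_image hs]; rfl

lemma exists_dual_point_eq (l : (quadricGeometry χ).dual.Pt) :
    ∃ (U : Submodule F (Fin n → F)) (hU : finrank F U = 2) (hs : IsTotallySingular χ U),
      l = ⟨pointsIn χ U, mem_lines_iff.2 ⟨U, hU, hs, rfl⟩⟩ := by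
  obtain ⟨l, hl⟩ := l
  obtain ⟨U, hU, hs, rfl⟩ := mem_lines_iff.1 hl
  exact ⟨U, hU, hs, rfl⟩

lemma veroneseVec_mem_spanH {x : Fin n → F} (hx : χ x = 0) : veroneseVec x ∈ spanH χ := by
  by_cases hx0 : x = 0
  · have : veroneseVec x = 0 := by subst hx0; ext p; simp [veroneseVec]
    rw [this]; exact zero_mem _
  · let p : (quadricGeometry χ).Pt := ⟨span F {x}, finrank_span_singleton hx0,
      isTotallySingular_span_singleton hx⟩
    refine (le_iSup (naturalVeronesean χ) p : _ ≤ spanH χ) ?_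
    change veroneseVec x ∈ veronese (span F {x})
    rw [veronese_span_singleton]
    exact mem_span_singleton_self _

lemma spanH_le {S : Submodule F (VeroneseSpace F n)} (hS : ∀ x, χ x = 0 → veroneseVec x ∈ S) :
    spanH χ ≤ S := by
  refine iSup_le fun p => ?_
  obtain ⟨x, -, hx, hp⟩ := quadricGeometry_point p
  change veronese p.1 ≤ S
  rw [hp, veronese_span_singleton, span_singleton_le_iff_mem]
  exact hS x hx

lemma sSup_veroneseImage_le_spanH {U : Submodule F (Fin n → F)} (hs : IsTotallySingular χ U) :
    sSup (veroneseImage U) ≤ spanH χ := by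
  rw [← lineSpan_naturalVeronesean hs]
  exact iSup₂_le fun p _ => le_iSup (naturalVeronesean χ) p

lemma polarBilin_eq_zero_of_singular {x y : Fin n → F} (hx : χ x = 0) (hy : χ y = 0)
    (hxy : χ (x + y) = 0) : χ.polarBilin x y = 0 := by
  rw [quadraticForm_add, hx, hy] at hxy
  simpa only [zero_add] using hxy

variable [CharP F 2]

lemma map_grassmannEmbedding (l : (quadricGeometry χ).dual.Pt) :
    (grassmannEmbedding (quadricGeometry χ) (naturalEmbedding χ) l).map wedgeToVeronese =
      nucleusEmbedding (quadricGeometry χ) (naturalEmbedding χ) l := by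
  obtain ⟨U, hU, hs, rfl⟩ := exists_dual_point_eq l
  rw [nucleusEmbedding_eq hs]
  change (pluecker (lineSpan (naturalEmbedding χ) (pointsIn χ U))).map _ = _
  rw [lineSpan_naturalEmbedding hs, map_pluecker hU]

lemma isLocalEmbeddingInSpan_naturalVeronesean :
    IsLocalEmbeddingInSpan (quadricGeometry χ) 2 (naturalVeronesean χ) where
  pos := two_pos
  point p := by
    obtain ⟨x, hx0, -, hp⟩ := quadricGeometry_point p
    change finrank F (veronese p.1) = 1
    rw [hp, veronese_span_singleton]
    apply finrank_span_singleton
    intro h0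
    refine hx0 (funext fun i => mul_self_eq_zero.1 ?_)
    exact congrFun h0 ⟨(i, i), le_rfl⟩
  injective p q h := by
    obtain ⟨x, hx0, -, hp⟩ := quadricGeometry_point p
    obtain ⟨y, hy0, -, hq⟩ := quadricGeometry_point q
    change veronese p.1 = veronese q.1 at h
    have hle : p.1 ≤ q.1 := by
      rw [hp, span_singleton_le_iff_mem]
      apply mem_of_veroneseVec_mem
      apply mem_sup_left
      refine (show veronese q.1 ≤ sSup (veroneseImage q.1) from
        le_sSup ⟨q.1, q.2.1, le_rfl, rfl⟩) ?_
      rw [← h, hp, veronese_span_singleton]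
      exact mem_span_singleton_self _
    have : Module.Finite F q.1 := Module.finite_of_finrank_pos (by rw [q.2.1]; norm_num)
    exact Subtype.ext (eq_of_le_of_finrank_eq hle (by rw [p.2.1, q.2.1]))
  line_dim := by
    intro l hl
    obtain ⟨U, hU, hs, rfl⟩ := mem_lines_iff.1 hl
    rw [lineSpan_naturalVeronesean hs, finrank_sSup_veroneseImage hU]
  line_full := by
    intro l hl p hle
    obtain ⟨U, hU, hs, rfl⟩ := mem_lines_iff.1 hl
    obtain ⟨x, hx0, -, hp⟩ := quadricGeometry_point p
    change veronese p.1 ≤ _ at hle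
    rw [lineSpan_naturalVeronesean hs, hp, veronese_span_singleton,
      span_singleton_le_iff_mem] at hle
    change p.1 ≤ U
    rw [hp, span_singleton_le_iff_mem]
    exact mem_of_veroneseVec_mem (mem_sup_left hle)

/-- The disjointness conditions already hold for N and pass to the smaller N_H. The plane of a conic
meets N in the nucleus, which lies in H, so nothing is lost there by intersecting with H. -/
lemma definesQuotient_spanNHinH :
    DefinesQuotient (quadricGeometry χ) 2 1 (naturalVeroneseanH χ) (spanNHinH χ) := by
  apply definesQuotient_restrictToSpan (ε := naturalVeronesean χ) (K := spanNH χ) inf_le_left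
  · intro p q
    obtain ⟨x, -, -, hp⟩ := quadricGeometry_point p
    obtain ⟨y, -, -, hq⟩ := quadricGeometry_point q
    change (veronese p.1 ⊔ veronese q.1) ⊓ _ = ⊥
    rw [hp, hq, veronese_span_singleton, veronese_span_singleton, eq_bot_iff,
      ← span_veroneseVec_pair_inf x y]
    exact inf_le_inf_left _ inf_le_right
  · intro l hl p hp
    obtain ⟨U, hU, hs, rfl⟩ := mem_lines_iff.1 hl
    obtain ⟨x, hx0, -, hpx⟩ := quadricGeometry_point p
    rw [lineSpan_naturalVeronesean hs, eq_bot_iff]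
    rintro z ⟨hz, hzU⟩
    change z ∈ veronese p.1 at hz
    rw [hpx, veronese_span_singleton] at hz
    obtain ⟨c, rfl⟩ := mem_span_singleton.1 hz
    by_cases hc : c = 0
    · rw [hc, zero_smul]; exact zero_mem _
    exfalso
    apply hp
    change p.1 ≤ U
    rw [hpx, span_singleton_le_iff_mem]
    have hle : sSup (veroneseImage U) ⊔ spanNH χ ≤ sSup (veroneseImage U) ⊔ nucleusSpan F n :=
      sup_le_sup le_rfl inf_le_right
    exact mem_of_veroneseVec_mem (hle ((smul_mem_iff _ hc).1 hzU))
  · norm_num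
  · intro l hl
    obtain ⟨U, hU, hs, rfl⟩ := mem_lines_iff.1 hl
    rw [lineSpan_naturalVeronesean hs, spanNH, inf_assoc, nucleusSpan_inf_sSup hU,
      inf_eq_right.2 ((lineNucleus_le_sSup hU).trans (sSup_veroneseImage_le_spanH hs)),
      finrank_lineNucleus hU]

lemma spanNGamma_le_spanNH : spanNGamma χ ≤ spanNH χ := by
  refine iSup_le fun l => ?_
  obtain ⟨U, hU, hs, rfl⟩ := exists_dual_point_eq l
  rw [nucleusEmbedding_eq hs]
  exact le_inf ((lineNucleus_le_sSup hU).trans (sSup_veroneseImage_le_spanH hs))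
    (lineNucleus_le_nucleusSpan hU)

/-- Collinearity on the quadric is phrased as three values of χ, which can be computed in
coordinates; dependent pairs are harmless because their polarization is zero. -/
lemma veronesePolar_mem_spanNGamma {x y : Fin n → F} (hx : χ x = 0) (hy : χ y = 0)
    (hxy : χ (x + y) = 0) : veronesePolar x y ∈ spanNGamma χ := by
  by_cases hi : LinearIndependent F ![x, y]
  · have hs := isTotallySingular_span_pair hx hy (polarBilin_eq_zero_of_singular hx hy hxy)
    have hU := finrank_span_pair hi
    have hl : pointsIn χ (span F {x, y}) ∈ (quadricGeometry χ).lines :=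
      mem_lines_iff.2 ⟨_, hU, hs, rfl⟩
    refine (le_iSup (nucleusEmbedding (quadricGeometry χ) (naturalEmbedding χ)) ⟨_, hl⟩ :
      _ ≤ spanNGamma χ) ?_
    rw [nucleusEmbedding_eq hs, lineNucleus_span_pair hi]
    exact mem_span_singleton_self _
  · rw [veronesePolar_eq_zero_iff.2 hi]; exact zero_mem _

end Quadric

universe u

/-! ### Coordinates with respect to a normal basis -/

section NormalForm

variable {F V : Type u} [Field F] [AddCommGroup V] [Module F V] {χ : QuadraticForm F V}

lemma normal_form_apply {b : Basis (Fin 5) F V} {a : F}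
    (hb : ∀ c : Fin 5 → F, χ (∑ i, c i • b i) = a * (c 0 * c 2 + c 1 * c 3 + c 4 * c 4)) (v : V) :
    χ v = a * (b.coord 0 v * b.coord 2 v + b.coord 1 v * b.coord 3 v
      + b.coord 4 v * b.coord 4 v) := by
  have := hb (b.repr v)
  rwa [b.sum_repr] at this

lemma eq_sum_coord (b : Basis (Fin 5) F V) (v : V) :
    v = b.coord 0 v • b 0 + b.coord 1 v • b 1 + b.coord 2 v • b 2 + b.coord 3 v • b 3
      + b.coord 4 v • b 4 := by
  have := b.sum_repr v
  rw [Fin.sum_univ_five] at this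
  exact this.symm

lemma coord_basis (b : Basis (Fin 5) F V) (i j : Fin 5) :
    b.coord i (b j) = if j = i then 1 else 0 := by
  rw [Basis.coord_apply, Basis.repr_self, Finsupp.single_apply]

end NormalForm

/-! ### The quadrangle Q(4, F): N_Γ, H/N_H and the dual embeddings -/

section Quadrangle

variable {F : Type u} [Field F] {χ : QuadraticForm F (Fin 5 → F)} {b : Basis (Fin 5) F (Fin 5 → F)}
  {a : F}

/-- The form χ itself is a linear functional on V^⊗; its kernel is a hyperplane containing H but not
π(b₀, b₂). -/
lemma exists_functional (hb : ∀ c : Fin 5 → F, χ (∑ i, c i • b i) =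
      a * (c 0 * c 2 + c 1 * c 3 + c 4 * c 4)) :
    ∃ Q : VeroneseSpace F 5 →ₗ[F] F, (∀ x, Q (veroneseVec x) = χ x) ∧
      Q (veronesePolar (b 0) (b 2)) = a := by
  obtain ⟨Q₁, h1⟩ := exists_productForm (b.coord 0) (b.coord 2)
  obtain ⟨Q₂, h2⟩ := exists_productForm (b.coord 1) (b.coord 3)
  obtain ⟨Q₃, h3⟩ := exists_productForm (b.coord 4) (b.coord 4)
  refine ⟨a • (Q₁ + Q₂ + Q₃), fun x => ?_, ?_⟩
  · simp only [LinearMap.smul_apply, LinearMap.add_apply, h1, h2, h3, smul_eq_mul,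
      normal_form_apply hb x]
  · simp [map_veronesePolar h1, map_veronesePolar h2, map_veronesePolar h3]

lemma singular_of_coord (hb : ∀ c : Fin 5 → F, χ (∑ i, c i • b i) =
      a * (c 0 * c 2 + c 1 * c 3 + c 4 * c 4)) {x : Fin 5 → F}
    (h : b.coord 0 x * b.coord 2 x + b.coord 1 x * b.coord 3 x + b.coord 4 x * b.coord 4 x = 0) :
    χ x = 0 := by
  rw [normal_form_apply hb, h, mul_zero]

lemma naturalVeroneseanH_eq {p : (quadricGeometry χ).Pt} {x : Fin 5 → F} (hx : χ x = 0)
    (hp : p.1 = span F {x}) :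
    naturalVeroneseanH χ p = span F {(⟨veroneseVec x, veroneseVec_mem_spanH hx⟩ : spanH χ)} := by
  apply map_injective_of_injective (subtype_injective (spanH χ))
  rw [map_span, Set.image_singleton]
  refine (map_restrictToSpan (naturalVeronesean χ) p).trans ?_
  change veronese p.1 = _
  rw [hp, veronese_span_singleton]
  rfl

/-- The lines of the quadric through a point `p`, as a line of the dual geometry. -/
def pencil (p : (quadricGeometry χ).Pt) : Set (quadricGeometry χ).dual.Pt :=
  {l | p ∈ l.1}

lemma mem_dual_lines_iff {s : Set (quadricGeometry χ).dual.Pt} :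
    s ∈ (quadricGeometry χ).dual.lines ↔ ∃ p, s = pencil p := Iff.rfl

/-- A relation has the form π(b₀, u) = 0, and for k ≠ 0 the functional of the product of coordinates
0 and k extracts coordinate k of u. -/
lemma linearIndependent_pencil (b : Basis (Fin 5) F (Fin 5 → F)) : LinearIndependent F
    ![veronesePolar (b 0) (b 1), veronesePolar (b 0) (b 3), veronesePolar (b 0) (b 4)] := by
  rw [Fintype.linearIndependent_iff]
  intro g hg
  have h : ∀ k : Fin 5, k ≠ 0 → b.coord k (g 0 • b 1 + g 1 • b 3 + g 2 • b 4) = 0 := by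
    intro k hk
    obtain ⟨Q, hQ⟩ := exists_productForm (b.coord 0) (b.coord k)
    have := congrArg Q hg
    simp only [Fin.sum_univ_three, ← map_smul, ← map_add, map_zero, Matrix.cons_val] at this
    rw [map_veronesePolar hQ] at this
    simpa [-Basis.coord_apply, coord_basis, hk.symm] using this
  have h1 := h 1 (by decide)
  have h3 := h 3 (by decide)
  have h4 := h 4 (by decide)
  simp [-Basis.coord_apply, coord_basis] at h1 h3 h4
  intro i; fin_cases i
  exacts [h1, h3, h4]

variable [CharP F 2]

lemma exists_normal_basis_of_singular (hns : IsNonsingular χ) (hwitt : HasWittIndex χ 2)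
    {x : Fin 5 → F} (hx : χ x = 0) (hx0 : x ≠ 0) :
    ∃ (b : Basis (Fin 5) F (Fin 5 → F)) (a : F), a ≠ 0 ∧ b 0 = x ∧
      ∀ c : Fin 5 → F, χ (∑ i, c i • b i) = a * (c 0 * c 2 + c 1 * c 3 + c 4 * c 4) := by
  obtain ⟨y, hi, hs⟩ := exists_singular_line hwitt hx hx0
  obtain ⟨b, a, ha, h0, -, hb⟩ := exists_normal_basis (by simp) hns hi hs
  exact ⟨b, a, ha, h0, hb⟩

lemma exists_basis_normal_form (hns : IsNonsingular χ) (hwitt : HasWittIndex χ 2) :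
    ∃ (b : Basis (Fin 5) F (Fin 5 → F)) (a : F), a ≠ 0 ∧
      ∀ c : Fin 5 → F, χ (∑ i, c i • b i) = a * (c 0 * c 2 + c 1 * c 3 + c 4 * c 4) := by
  obtain ⟨U, hs, hU⟩ := hwitt.1
  obtain ⟨x, y, hi, rfl⟩ := exists_eq_span_pair hU
  obtain ⟨b, a, ha, -, -, hb⟩ := exists_normal_basis (by simp) hns hi hs
  exact ⟨b, a, ha, hb⟩

/-- Eight of the ten basis polarizations lie in N_Γ, and N_Γ contains the sum of the remaining two,
π(b₀, b₂) and π(b₁, b₃), so one extra vector suffices. -/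
lemma veronesePolar_basis_mem (hb : ∀ c : Fin 5 → F, χ (∑ i, c i • b i) =
      a * (c 0 * c 2 + c 1 * c 3 + c 4 * c 4)) (i j : Fin 5) :
    veronesePolar (b i) (b j) ∈ spanNGamma χ ⊔ span F {veronesePolar (b 0) (b 2)} := by
  set S := spanNGamma χ ⊔ span F {veronesePolar (b 0) (b 2)} with hS
  have hle : spanNGamma χ ≤ S := le_sup_left
  have hmem : ∀ x y, b.coord 0 x * b.coord 2 x + b.coord 1 x * b.coord 3 x
        + b.coord 4 x * b.coord 4 x = 0 →
      b.coord 0 y * b.coord 2 y + b.coord 1 y * b.coord 3 y + b.coord 4 y * b.coord 4 y = 0 →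
      b.coord 0 (x + y) * b.coord 2 (x + y) + b.coord 1 (x + y) * b.coord 3 (x + y)
        + b.coord 4 (x + y) * b.coord 4 (x + y) = 0 → veronesePolar x y ∈ S :=
    fun x y hx hy hxy => hle (veronesePolar_mem_spanNGamma (singular_of_coord hb hx)
      (singular_of_coord hb hy) (singular_of_coord hb hxy))
  simp only [map_add] at hmem
  have h02 : veronesePolar (b 0) (b 2) ∈ S := mem_sup_right (mem_span_singleton_self _)
  have h01 : veronesePolar (b 0) (b 1) ∈ S := by
    apply hmem <;> simp [-Basis.coord_apply, coord_basis]
  have h03 : veronesePolar (b 0) (b 3) ∈ S := by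
    apply hmem <;> simp [-Basis.coord_apply, coord_basis]
  have h12 : veronesePolar (b 1) (b 2) ∈ S := by
    apply hmem <;> simp [-Basis.coord_apply, coord_basis]
  have h23 : veronesePolar (b 2) (b 3) ∈ S := by
    apply hmem <;> simp [-Basis.coord_apply, coord_basis]
  -- The vector b₄ is not singular, but b₁ + b₃ + b₄ is, and it is orthogonal to b₀. The next three
  -- cases are analogous.
  have h04 : veronesePolar (b 0) (b 4) ∈ S := by
    have : veronesePolar (b 0) (b 1 + b 3 + b 4) ∈ S := by
      apply hmem <;> simp [-Basis.coord_apply, coord_basis, CharTwo.add_self_eq_zero]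
    rw [map_add, map_add] at this
    exact (S.add_mem_iff_right (S.add_mem h01 h03)).1 this
  have h24 : veronesePolar (b 2) (b 4) ∈ S := by
    have : veronesePolar (b 2) (b 1 + b 3 + b 4) ∈ S := by
      apply hmem <;> simp [-Basis.coord_apply, coord_basis, CharTwo.add_self_eq_zero]
    rw [map_add, map_add, veronesePolar_comm (b 2) (b 1)] at this
    exact (S.add_mem_iff_right (S.add_mem h12 h23)).1 this
  have h14 : veronesePolar (b 1) (b 4) ∈ S := by
    have : veronesePolar (b 1) (b 0 + b 2 + b 4) ∈ S := by
      apply hmem <;> simp [-Basis.coord_apply, coord_basis, CharTwo.add_self_eq_zero]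
    rw [map_add, map_add, veronesePolar_comm (b 1) (b 0)] at this
    exact (S.add_mem_iff_right (S.add_mem h01 h12)).1 this
  have h34 : veronesePolar (b 3) (b 4) ∈ S := by
    have : veronesePolar (b 3) (b 0 + b 2 + b 4) ∈ S := by
      apply hmem <;> simp [-Basis.coord_apply, coord_basis, CharTwo.add_self_eq_zero]
    rw [map_add, map_add, veronesePolar_comm (b 3) (b 0), veronesePolar_comm (b 3) (b 2)] at this
    exact (S.add_mem_iff_right (S.add_mem h03 h23)).1 this
  have h13 : veronesePolar (b 1) (b 3) ∈ S := by
    -- The singular vectors b₀ + b₁ and b₂ + b₃ are orthogonal because B(b₀, b₂) + B(b₁, b₃) = 2a =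
    -- 0, so π(b₁, b₃) is tied to π(b₀, b₂).
    have : veronesePolar (b 0 + b 1) (b 2 + b 3) ∈ S := by
      apply hmem <;> simp [-Basis.coord_apply, coord_basis, CharTwo.add_self_eq_zero]
    simp only [map_add, LinearMap.add_apply] at this
    exact (S.add_mem_iff_right h12).1 ((S.add_mem_iff_right (S.add_mem h02 h03)).1
      (by convert this using 1; abel))
  have hlt : ∀ i j : Fin 5, i < j → veronesePolar (b i) (b j) ∈ S := by
    intro i j hij
    fin_cases i <;> fin_cases j <;> first | exact absurd hij (by decide) | assumption
  rcases lt_trichotomy i j with h | h | h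
  · exact hlt i j h
  · rw [h, veronesePolar_self]; exact zero_mem _
  · rw [veronesePolar_comm]; exact hlt j i h

/-- An element of N is w + cπ(b₀, b₂) with w in N_Γ; if it also lies in H, the functional of χ gives
ca = 0. -/
lemma spanNGamma_eq_spanNH (hns : IsNonsingular χ) (hwitt : HasWittIndex χ 2) :
    spanNGamma χ = spanNH χ := by
  refine le_antisymm spanNGamma_le_spanNH ?_
  obtain ⟨b, a, ha, hb⟩ := exists_basis_normal_form hns hwitt
  obtain ⟨Q, hQ, hQa⟩ := exists_functional hb
  have hH : spanH χ ≤ LinearMap.ker Q := spanH_le fun x hx => by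
    rw [LinearMap.mem_ker, hQ, hx]
  have hN : nucleusSpan F 5 ≤ spanNGamma χ ⊔ span F {veronesePolar (b 0) (b 2)} := by
    refine nucleusSpan_le fun x y => ?_
    rw [← b.sum_repr x, ← b.sum_repr y]
    simp only [map_sum, LinearMap.sum_apply, map_smul, LinearMap.smul_apply]
    exact sum_mem fun i _ => smul_mem _ _ (sum_mem fun j _ =>
      smul_mem _ _ (veronesePolar_basis_mem hb _ _))
  rintro z ⟨hzH, hzN⟩
  obtain ⟨w, hw, t, ht, rfl⟩ := mem_sup.1 (hN hzN)
  obtain ⟨c, rfl⟩ := mem_span_singleton.1 ht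
  have hw0 : Q w = 0 := hH (spanNGamma_le_spanNH hw).1
  have hz0 : Q (w + c • veronesePolar (b 0) (b 2)) = 0 := hH hzH
  rw [map_add, map_smul, hw0, hQa, zero_add, smul_eq_mul] at hz0
  have hc : c = 0 := by simpa [ha] using hz0
  rw [hc, zero_smul, add_zero]
  exact hw

lemma diagonal_veroneseVec_add (x y : Fin 5 → F) : diagonal (veroneseVec (x + y)) =
    diagonal (veroneseVec x) + diagonal (veroneseVec y) := by
  rw [veroneseVec_add, map_add, map_add, diagonal_veronesePolar, add_zero]

/-- As squaring is additive, the x whose vector of squares lies in the image of H form a subspace.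
It contains all singular vectors, and these span V: b₄ comes from b₀ + b₂ + b₄. The standard basis
vectors equal their own vectors of squares, so the image is everything even if F is not perfect. -/
lemma map_diagonal_spanH (hns : IsNonsingular χ) (hwitt : HasWittIndex χ 2) :
    (spanH χ).map diagonal = ⊤ := by
  obtain ⟨b, a, ha, hb⟩ := exists_basis_normal_form hns hwitt
  let T : Submodule F (Fin 5 → F) :=
    { carrier := {x | diagonal (veroneseVec x) ∈ (spanH χ).map diagonal}
      add_mem' := fun {x y} hx hy => by
        rw [Set.mem_ofPred_eq, diagonal_veroneseVec_add]; exact add_mem hx hy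
      zero_mem' := by
        have : veroneseVec (0 : Fin 5 → F) = 0 := by ext p; simp [veroneseVec]
        rw [Set.mem_ofPred_eq, this, map_zero]; exact zero_mem _
      smul_mem' := fun c x hx => by
        rw [Set.mem_ofPred_eq, veroneseVec_smul, map_smul]; exact smul_mem _ _ hx }
  have hsing : ∀ x, b.coord 0 x * b.coord 2 x + b.coord 1 x * b.coord 3 x
      + b.coord 4 x * b.coord 4 x = 0 → x ∈ T := fun x hx =>
    mem_map_of_mem (veroneseVec_mem_spanH (singular_of_coord hb hx))
  have h0 : b 0 ∈ T := by apply hsing; simp [-Basis.coord_apply, coord_basis]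
  have h1 : b 1 ∈ T := by apply hsing; simp [-Basis.coord_apply, coord_basis]
  have h2 : b 2 ∈ T := by apply hsing; simp [-Basis.coord_apply, coord_basis]
  have h3 : b 3 ∈ T := by apply hsing; simp [-Basis.coord_apply, coord_basis]
  have h4 : b 4 ∈ T := by
    have : b 0 + b 2 + b 4 ∈ T := by
      apply hsing; simp [-Basis.coord_apply, coord_basis, CharTwo.add_self_eq_zero]
    exact (T.add_mem_iff_right (T.add_mem h0 h2)).1 this
  have hT : ∀ x, x ∈ T := by
    intro x
    rw [eq_sum_coord b x]
    exact T.add_mem (T.add_mem (T.add_mem (T.add_mem (T.smul_mem _ h0) (T.smul_mem _ h1))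
      (T.smul_mem _ h2)) (T.smul_mem _ h3)) (T.smul_mem _ h4)
  rw [eq_top_iff, ← (Pi.basisFun F (Fin 5)).span_eq, span_le]
  rintro _ ⟨i, rfl⟩
  have : diagonal (veroneseVec (Pi.basisFun F (Fin 5) i)) = Pi.basisFun F (Fin 5) i := by
    ext j; rw [diagonal_veroneseVec]; simp [Pi.single_apply]
  rw [← this]
  exact hT _

/-- The linear isomorphism `H / N_H ≃ V` induced by the projection on the diagonal coordinates. -/
lemma exists_quotient_equiv (hns : IsNonsingular χ) (hwitt : HasWittIndex χ 2) :
    ∃ e : (spanH χ ⧸ spanNHinH χ) ≃ₗ[F] (Fin 5 → F),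
      ∀ z : spanH χ, e ((spanNHinH χ).mkQ z) = diagonal (z : VeroneseSpace F 5) := by
  have hker : spanNHinH χ = LinearMap.ker (diagonal ∘ₗ (spanH χ).subtype) := by
    ext z
    have h1 : z ∈ spanNHinH χ ↔ (z : VeroneseSpace F 5) ∈ spanH χ ⊓ nucleusSpan F 5 := Iff.rfl
    rw [h1, nucleusSpan_eq_ker_diagonal, mem_inf, and_iff_right z.2]
    rfl
  have hsurj : Function.Surjective (diagonal ∘ₗ (spanH χ).subtype) := by
    rw [← LinearMap.range_eq_top, LinearMap.range_comp, range_subtype,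
      map_diagonal_spanH hns hwitt]
  exact ⟨(quotEquivOfEq _ _ hker).trans (LinearMap.quotKerEquivOfSurjective _ hsurj),
    fun z => rfl⟩

lemma embeddingIso_quotient (hns : IsNonsingular χ) (hwitt : HasWittIndex χ 2) [PerfectField F] :
    EmbeddingIso (quotientEmbedding (naturalVeroneseanH χ) (spanNHinH χ))
      (naturalEmbedding χ) := by
  obtain ⟨e, he⟩ := exists_quotient_equiv hns hwitt
  -- The identification of H/N_H with V sends the class of η(x) to (x_i²); extracting square roots
  -- coordinatewise is semilinear for this σ.
  let σ := (frobeniusEquiv F 2).symm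
  have hσ : ∀ c, σ (c * c) = c := fun c => by
    have := frobeniusEquiv_symm_apply_frobenius F 2 c
    rwa [frobenius_def, sq] at this
  let f : (spanH χ ⧸ spanNHinH χ) →ₛₗ[(σ : F →+* F)] (Fin 5 → F) :=
    { toFun := fun z i => σ (e z i)
      map_add' := fun y z => by ext i; simp
      map_smul' := fun c z => by ext i; simp }
  have hf : ∀ z, f z = fun i => σ (e z i) := fun z => rfl
  refine ⟨σ, f, ⟨fun y z hyz => ?_, fun v => ?_⟩, fun p => ?_⟩
  · apply e.injective
    ext i
    exact σ.injective (congrFun hyz i)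
  · refine ⟨e.symm fun i => σ.symm (v i), ?_⟩
    rw [hf, e.apply_symm_apply]
    ext i
    exact σ.apply_symm_apply (v i)
  · obtain ⟨x, -, hx, hp⟩ := quadricGeometry_point p
    rw [quotientEmbedding, naturalVeroneseanH_eq hx hp, map_span, Set.image_singleton, map_span,
      Set.image_singleton]
    change _ = p.1
    rw [hp, hf, he]
    congr 2
    ext i
    exact hσ (x i)

/-- The spans of the pencils of the dual quadrangle. -/
lemma lineSpan_nucleusEmbedding_pencil (ha : a ≠ 0)
    (hb : ∀ c : Fin 5 → F, χ (∑ i, c i • b i) = a * (c 0 * c 2 + c 1 * c 3 + c 4 * c 4))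
    {p : (quadricGeometry χ).Pt} (hp : p.1 = span F {b 0}) :
    lineSpan (nucleusEmbedding (quadricGeometry χ) (naturalEmbedding χ))
      (pencil p) =
    span F {veronesePolar (b 0) (b 1), veronesePolar (b 0) (b 3), veronesePolar (b 0) (b 4)} := by
  apply le_antisymm
  · refine iSup₂_le fun l hl => ?_
    obtain ⟨U, hU, hs, rfl⟩ := exists_dual_point_eq l
    have hbU : b 0 ∈ U := by
      rw [← span_singleton_le_iff_mem, ← hp]; exact hl
    obtain ⟨v, hi, rfl⟩ := exists_eq_span_pair_of_mem hU hbU (b.ne_zero 0)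
    rw [nucleusEmbedding_eq hs, lineNucleus_span_pair hi, span_singleton_le_iff_mem]
    have hv : v ∈ span F {b 0, v} := subset_span (by simp)
    have h1 := hs v hv
    have h2 := hs (b 0 + v) (add_mem hbU hv)
    rw [normal_form_apply hb] at h1 h2
    simp only [map_add, coord_basis] at h2
    simp only [if_true, Fin.isValue, Fin.reduceEq, if_false, zero_add] at h2
    -- The difference χ(b₀ + v) − χ(v) is B(b₀, v), which is a times coordinate 2 of v: lines
    -- through b₀ stay in b₀^⊥.
    have hc : a * b.coord 2 v = 0 := by linear_combination h2 - h1
    have hc2 : b.coord 2 v = 0 := by simpa [-Basis.coord_apply, ha] using hc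
    rw [eq_sum_coord b v, hc2]
    simp only [map_add, map_smul, veronesePolar_self, smul_zero, zero_add, zero_smul, add_zero]
    exact mem_span_triple.2 ⟨_, _, _, rfl⟩
  · have key : ∀ y, χ y = 0 → χ (b 0 + y) = 0 → veronesePolar (b 0) y ∈
        lineSpan (nucleusEmbedding (quadricGeometry χ) (naturalEmbedding χ))
          (pencil p) := by
      intro y hy hby
      by_cases hi : LinearIndependent F ![b 0, y]
      · have h0 : χ (b 0) = 0 := singular_of_coord hb (by simp [-Basis.coord_apply, coord_basis])
        have hs := isTotallySingular_span_pair h0 hy (polarBilin_eq_zero_of_singular h0 hy hby)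
        have hl : pointsIn χ (span F {b 0, y}) ∈ (quadricGeometry χ).lines :=
          mem_lines_iff.2 ⟨_, finrank_span_pair hi, hs, rfl⟩
        have hpl : p ∈ pointsIn χ (span F {b 0, y}) := by
          rw [mem_pointsIn, hp]; exact span_mono (by simp)
        have hle : nucleusEmbedding (quadricGeometry χ) (naturalEmbedding χ) ⟨_, hl⟩ ≤
            lineSpan (nucleusEmbedding (quadricGeometry χ) (naturalEmbedding χ))
              (pencil p) :=
          le_iSup₂_of_le (⟨_, hl⟩ : (quadricGeometry χ).dual.Pt) hpl le_rfl
        apply hle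
        rw [nucleusEmbedding_eq hs, lineNucleus_span_pair hi]
        exact mem_span_singleton_self _
      · rw [veronesePolar_eq_zero_iff.2 hi]; exact zero_mem _
    have h1 := key (b 1) (singular_of_coord hb (by simp [-Basis.coord_apply, coord_basis]))
      (singular_of_coord hb (by simp [-Basis.coord_apply, coord_basis]))
    have h3 := key (b 3) (singular_of_coord hb (by simp [-Basis.coord_apply, coord_basis]))
      (singular_of_coord hb (by simp [-Basis.coord_apply, coord_basis]))
    -- The pair b₀, b₄ does not span a line of the quadric; π(b₀, b₄) is obtained from the singular
    -- vector b₁ + b₃ + b₄.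
    have h4 := key (b 1 + b 3 + b 4)
      (singular_of_coord hb
        (by simp [-Basis.coord_apply, coord_basis, CharTwo.add_self_eq_zero]))
      (singular_of_coord hb
        (by simp [-Basis.coord_apply, coord_basis, CharTwo.add_self_eq_zero]))
    rw [map_add, map_add] at h4
    rw [span_le]
    rintro _ (rfl | rfl | rfl)
    · exact h1
    · exact h3
    · exact (Submodule.add_mem_iff_right _ (add_mem h1 h3)).1 h4

lemma isLocalEmbeddingInSpan_nucleusEmbedding (hns : IsNonsingular χ) (hwitt : HasWittIndex χ 2) :
    IsLocalEmbeddingInSpan (quadricGeometry χ).dual 2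
      (nucleusEmbedding (quadricGeometry χ) (naturalEmbedding χ)) where
  pos := two_pos
  point l := by
    obtain ⟨U, hU, hs, rfl⟩ := exists_dual_point_eq l
    rw [nucleusEmbedding_eq hs, finrank_lineNucleus hU]
  injective l l' h := by
    obtain ⟨U, hU, hs, rfl⟩ := exists_dual_point_eq l
    obtain ⟨U', hU', hs', rfl⟩ := exists_dual_point_eq l'
    rw [nucleusEmbedding_eq hs, nucleusEmbedding_eq hs'] at h
    have : U = U' :=
      le_antisymm (le_of_lineNucleus_eq hU' hU h.symm) (le_of_lineNucleus_eq hU hU' h)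
    subst this
    rfl
  line_dim := by
    intro s hs
    obtain ⟨p, rfl⟩ := mem_dual_lines_iff.1 hs
    obtain ⟨x, hx0, hx, hp⟩ := quadricGeometry_point p
    obtain ⟨b, a, ha, rfl, hb⟩ := exists_normal_basis_of_singular hns hwitt hx hx0
    rw [lineSpan_nucleusEmbedding_pencil ha hb hp]
    have := finrank_span_eq_card (linearIndependent_pencil b)
    rw [Matrix.range_cons, Matrix.range_cons, Matrix.range_cons, Matrix.range_empty,
      Set.union_empty] at this
    exact this
  line_full := by
    intro s hs l hl
    obtain ⟨p, rfl⟩ := mem_dual_lines_iff.1 hs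
    obtain ⟨x, hx0, hx, hp⟩ := quadricGeometry_point p
    obtain ⟨b, a, ha, rfl, hb⟩ := exists_normal_basis_of_singular hns hwitt hx hx0
    rw [lineSpan_nucleusEmbedding_pencil ha hb hp] at hl
    obtain ⟨U, hU, hs, rfl⟩ := exists_dual_point_eq l
    obtain ⟨u, v, hi, rfl⟩ := exists_eq_span_pair hU
    rw [nucleusEmbedding_eq hs, lineNucleus_span_pair hi, span_singleton_le_iff_mem] at hl
    obtain ⟨c₁, c₂, c₃, hc⟩ := mem_span_triple.1 hl
    rw [← (veronesePolar (b 0)).map_smul, ← (veronesePolar (b 0)).map_smul,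
      ← (veronesePolar (b 0)).map_smul, ← (veronesePolar (b 0)).map_add,
      ← (veronesePolar (b 0)).map_add] at hc
    -- Every element of the span of the pencil has the form π(b₀, z); if it equals π(u, v) ≠ 0, then
    -- b₀ lies on ⟨u, v⟩.
    have hmem := mem_span_pair_of_veronesePolar_eq hc.symm (by
      rw [hc, Ne, veronesePolar_eq_zero_iff, not_not]; exact hi)
    change p ∈ pointsIn χ _
    rwa [mem_pointsIn, hp, span_singleton_le_iff_mem]

lemma isLocalEmbeddingInSpan_grassmannEmbedding (hns : IsNonsingular χ)
    (hwitt : HasWittIndex χ 2) :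
    IsLocalEmbeddingInSpan (quadricGeometry χ).dual 2
      (grassmannEmbedding (quadricGeometry χ) (naturalEmbedding χ)) := by
  have h : (fun l => (grassmannEmbedding (quadricGeometry χ) (naturalEmbedding χ) l).map
      wedgeToVeronese) = nucleusEmbedding (quadricGeometry χ) (naturalEmbedding χ) :=
    funext map_grassmannEmbedding
  exact IsLocalEmbeddingInSpan.of_map wedgeToVeronese_injective
    (h ▸ isLocalEmbeddingInSpan_nucleusEmbedding hns hwitt)

end Quadrangle

end ConicNuclei

theorem proposition4p6 {F : Type*} [Field F] [CharP F 2]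
    (χ : QuadraticForm F (Fin 5 → F))
    (hns : ConicNuclei.IsNonsingular χ) (hwitt : ConicNuclei.HasWittIndex χ 2) :
    -- the dual of the quadrangle of `χ` is `W(3, F)`
    (ConicNuclei.quadricGeometry χ).dual.Isomorphic (ConicNuclei.symplecticQuadrangle F) ∧
    -- `ν` is well defined: it maps the lines of `PG(4, F)` to points
    (∀ U : Submodule F (Fin 5 → F), Module.finrank F U = 2 →
      Module.finrank F (ConicNuclei.lineNucleus U) = 1) ∧
    -- `N_Γ = N_H`
    ConicNuclei.spanNGamma χ = ConicNuclei.spanNH χ ∧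
    -- `ε₀^ver` is a 2-embedding in `PG(H)`, and `N_H` defines a quotient of it, a 1-embedding
    ConicNuclei.IsLocalEmbedding (ConicNuclei.quadricGeometry χ) 2
      (ConicNuclei.naturalVeroneseanH χ) ∧
    ConicNuclei.DefinesQuotient (ConicNuclei.quadricGeometry χ) 2 1
      (ConicNuclei.naturalVeroneseanH χ) (ConicNuclei.spanNHinH χ) ∧
    ConicNuclei.IsLocalEmbedding (ConicNuclei.quadricGeometry χ) 1
      (ConicNuclei.quotientEmbedding (ConicNuclei.naturalVeroneseanH χ)
        (ConicNuclei.spanNHinH χ)) ∧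
    -- the projective dimension of `ε₀^ver / N_H` is `4`
    Module.finrank F (ConicNuclei.spanH χ ⧸ ConicNuclei.spanNHinH χ) = 4 + 1 ∧
    -- the composition of `ν` with `ε₀^ver` and `ε₀^gr` are isomorphic embeddings of the dual
    ConicNuclei.IsLocalEmbedding (ConicNuclei.quadricGeometry χ).dual 2
      (ConicNuclei.restrictToSpan (ConicNuclei.nucleusEmbedding (ConicNuclei.quadricGeometry χ)
        (ConicNuclei.naturalEmbedding χ))) ∧
    ConicNuclei.IsLocalEmbedding (ConicNuclei.quadricGeometry χ).dual 2
      (ConicNuclei.restrictToSpan (ConicNuclei.grassmannEmbedding (ConicNuclei.quadricGeometry χ)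
        (ConicNuclei.naturalEmbedding χ))) ∧
    ConicNuclei.EmbeddingIso
      (ConicNuclei.restrictToSpan (ConicNuclei.nucleusEmbedding (ConicNuclei.quadricGeometry χ)
        (ConicNuclei.naturalEmbedding χ)))
      (ConicNuclei.restrictToSpan (ConicNuclei.grassmannEmbedding (ConicNuclei.quadricGeometry χ)
        (ConicNuclei.naturalEmbedding χ))) ∧
    -- the perfect case
    (PerfectField F →
      ConicNuclei.EmbeddingIso
        (ConicNuclei.quotientEmbedding (ConicNuclei.naturalVeroneseanH χ)
          (ConicNuclei.spanNHinH χ))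
        (ConicNuclei.naturalEmbedding χ)) := by
  obtain ⟨b, a, ha, hb⟩ := ConicNuclei.exists_basis_normal_form hns hwitt
  obtain ⟨T, hT⟩ := ConicNuclei.exists_isSpin ha hb
  obtain ⟨e, -⟩ := ConicNuclei.exists_quotient_equiv hns hwitt
  have hver := (ConicNuclei.isLocalEmbeddingInSpan_naturalVeronesean (χ := χ)).restrictToSpan
  have hquot := ConicNuclei.definesQuotient_spanNHinH (χ := χ)
  refine ⟨hT.dual_isomorphic (by simp) hns hwitt, fun U => ConicNuclei.finrank_lineNucleus,
    ConicNuclei.spanNGamma_eq_spanNH hns hwitt, hver, hquot, hver.quotient hquot, ?_,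
    (ConicNuclei.isLocalEmbeddingInSpan_nucleusEmbedding hns hwitt).restrictToSpan,
    (ConicNuclei.isLocalEmbeddingInSpan_grassmannEmbedding hns hwitt).restrictToSpan,
    ConicNuclei.embeddingIso_restrictToSpan_map ConicNuclei.wedgeToVeronese_injective
      ConicNuclei.map_grassmannEmbedding,
    fun _ => ConicNuclei.embeddingIso_quotient hns hwitt⟩
  rw [e.finrank_eq, Module.finrank_fin_fun]
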